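/- Let $S^1=\{z\in\mathbb{C}:|z|=1\}$. For a closed oriented smooth manifold $M$ of dimension $2n+1$ with a smooth fixed-point-free $S^1$-action $\psi$, let $\underline{X}_x=\frac{d}{d\theta}\big|_{\theta=0}\,e^{2\pi i\theta}\cdot x$. A normalized connection form on $M$ is a smooth $S^1$-invariant $1$-form $\alpha$ with $\alpha(\underline{X})\equiv 1$, and $$e(M,\psi)\;=\;\int_M \alpha\wedge(d\alpha)^n \pmod{\mathbb{Z}}\;\in\;\mathbb{R}/\mathbb{Z},$$ which is the Chern number $\langle c_1(E)^n,[M/S^1]\rangle$ modulo $\mathbb{Z}$ of the complex line orbibundle $E=M\times_{S^1}\mathbb{C}\to M/S^1$ if the action is effective; normalized connection forms exist, and $e(M,\psi)$ does not depend on the choice of $\alpha$. Proposition. Let $M_1$ and $M_2$ be closed smooth manifolds of positive dimension with smooth $S^1$-actions, where $\dim M_1+\dim M_2=2n+1$, and suppose that $M_1\times M_2$ is oriented. Let $\psi$ be the diagonal $S^1$-action on $M_1\times M_2$. If $\psi$ is fixed-point-free, then normalized connection forms exist on $M_1\times M_2$, the class modulo $\mathbb{Z}$ of $\int_{M_1\times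 M_2}\alpha\wedge(d\alpha)^n$ is the same for all of them, and $$e(M_1\times M_2,\psi)=0\in\mathbb{R}/\mathbb{Z}.$$ -/

import Mathlib

open scoped Manifold ContDiff

noncomputable section

namespace CircleEuler

/-! ### Wedge product of alternating forms on a vector space -/

section Wedge

variable {V : Type*} [AddCommGroup V] [Module ℝ V] [TopologicalSpace V]

theorem continuous_domCoprod {p q : ℕ} (a : V [⋀^Fin p]→L[ℝ] ℝ) (b : V [⋀^Fin q]→L[ℝ] ℝ) :
    Continuous fun v : Fin p ⊕ Fin q → V =>
      LinearMap.mul' ℝ ℝ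
        (AlternatingMap.domCoprod a.toAlternatingMap b.toAlternatingMap v) := by
  have key : ∀ v : Fin p ⊕ Fin q → V,
      LinearMap.mul' ℝ ℝ
        (AlternatingMap.domCoprod a.toAlternatingMap b.toAlternatingMap v) =
      ∑ σ : Equiv.Perm.ModSumCongr (Fin p) (Fin q), LinearMap.mul' ℝ ℝ
        (AlternatingMap.domCoprod.summand a.toAlternatingMap b.toAlternatingMap σ v) := by
    intro v
    rw [← map_sum, ← sum_apply, ← AlternatingMap.domCoprod_coe]
    rfl
  simp only [key]
  refine continuous_finsetSum _ fun σ _ => ?_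
  induction σ using Quotient.inductionOn' with
  | h σ =>
    simp only [AlternatingMap.domCoprod.summand_mk'', smul_apply,
      MultilinearMap.domDomCongr_apply, MultilinearMap.domCoprod_apply, map_zsmul_unit,
      LinearMap.mul'_apply]
    refine Continuous.const_smul (Continuous.mul ?_ ?_) _
    · exact a.cont.comp (continuous_pi fun i => continuous_apply _)
    · exact b.cont.comp (continuous_pi fun i => continuous_apply _)

/-- The wedge product
`(a ∧ b)(v₁, …, v_{p+q}) = ∑_σ sign(σ) a(v_{σ 1}, …, v_{σ p}) b(v_{σ(p+1)}, …, v_{σ(p+q)})`,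
the sum being over the `(p, q)`-shuffles. -/
def wedge {p q : ℕ} (a : V [⋀^Fin p]→L[ℝ] ℝ) (b : V [⋀^Fin q]→L[ℝ] ℝ) :
    V [⋀^Fin (p + q)]→L[ℝ] ℝ :=
  { ((LinearMap.mul' ℝ ℝ).compAlternatingMap
      (AlternatingMap.domCoprod a.toAlternatingMap b.toAlternatingMap)).domDomCongr
        finSumFinEquiv with
    cont := (continuous_domCoprod a b).comp (continuous_pi fun _ => continuous_apply _) }

/-- The wedge power `a ∧ ⋯ ∧ a` (`n` factors). -/
def wedgePow {p : ℕ} (a : V [⋀^Fin p]→L[ℝ] ℝ) : (n : ℕ) → V [⋀^Fin (p * n)]→L[ℝ] ℝ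
  | 0 => ContinuousAlternatingMap.constOfIsEmpty ℝ V (Fin 0) 1
  | n + 1 => wedge (wedgePow a n) a

end Wedge

/-! ### Differential forms on a manifold without boundary -/

section Forms

variable {E : Type*} [NormedAddCommGroup E] [NormedSpace ℝ E]
  {H : Type*} [TopologicalSpace H] (I : ModelWithCorners ℝ E H)
  (M : Type*) [TopologicalSpace M] [ChartedSpace H M]

/-- Differential forms of degree `k`, without regularity condition. -/
abbrev DForm (k : ℕ) : Type _ := ∀ x : M, TangentSpace I x [⋀^Fin k]→L[ℝ] ℝ

variable {I M}

/-- The expression of a form in the preferred chart at `x₀`: the pullback under the inverse chart,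
a form on the (open) target of the chart in the model vector space. -/
def DForm.inChart {k : ℕ} (η : DForm I M k) (x₀ : M) (y : E) : E [⋀^Fin k]→L[ℝ] ℝ :=
  (η ((extChartAt I x₀).symm y)).compContinuousLinearMap
    (mfderiv 𝓘(ℝ, E) I (extChartAt I x₀).symm y)

/-- A form is smooth if its expressions in charts are. -/
def DForm.IsSmooth {k : ℕ} (η : DForm I M k) : Prop :=
  ∀ x₀ : M, ContDiffOn ℝ ∞ (η.inChart x₀) (extChartAt I x₀).target

/-- The exterior derivative, computed in the chart at each point. -/
def DForm.d {k : ℕ} (η : DForm I M k) : DForm I M (k + 1) := fun x =>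
  (extDeriv (η.inChart x) (extChartAt I x x)).compContinuousLinearMap
    (mfderiv I 𝓘(ℝ, E) (extChartAt I x) x)

/-- An orientation of `M`, given by a smooth nowhere vanishing form `μ` of degree `k = dim M`:
a basis `v` of a tangent space is positive if and only if `μ v > 0`. -/
def DForm.IsOrientation {k : ℕ} (μ : DForm I M k) : Prop :=
  μ.IsSmooth ∧ ∀ x, μ x ≠ 0

end Forms

/-! ### Integration of top-degree forms -/

section Integral

variable {E : Type*} [NormedAddCommGroup E] [NormedSpace ℝ E] [FiniteDimensional ℝ E]
  [MeasurableSpace E] [BorelSpace E]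
  {H : Type*} [TopologicalSpace H] {I : ModelWithCorners ℝ E H} [I.Boundaryless]
  {M : Type*} [TopologicalSpace M] [ChartedSpace H M] [IsManifold I ∞ M]
  [T2Space M] [CompactSpace M]

variable (I M) in
/-- A smooth partition of unity subordinate to the charts. -/
def chartPartition : SmoothPartitionOfUnity M I M Set.univ :=
  (SmoothPartitionOfUnity.exists_isSubordinate_chartAt_source I M).choose

/-- The integral `∫_M η` of a top-degree form on a closed manifold oriented by `μ`: using a
partition of unity `ρ` subordinate to the charts, the sum over the charts `φ` of the integrals of
the coefficients of the forms `ρ η`, where the coefficient is taken with respect to a basis `b` of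
the model space, Lebesgue measure is normalized by `b`, and the sign is `+1` or `-1` according to
whether the chart maps the orientation `μ` to that of `b` or to the opposite one. -/
def integral {k : ℕ} (hk : Module.finrank ℝ E = k) (μ η : DForm I M k) : ℝ :=
  let b := Module.finBasisOfFinrankEq ℝ E hk
  ∑ᶠ i : M, ∫ y in (extChartAt I i).target,
    chartPartition I M i ((extChartAt I i).symm y) *
      ((SignType.sign (μ.inChart i y b) : ℝ) * η.inChart i y b) ∂b.addHaar

end Integral

/-! ### Circle actions -/

section Action

variable {E : Type*} [NormedAddCommGroup E] [NormedSpace ℝ E]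
  {H : Type*} [TopologicalSpace H] (I : ModelWithCorners ℝ E H)
  {M : Type*} [TopologicalSpace M] [ChartedSpace H M] [MulAction Circle M]

/-- The value at `x` of the fundamental vector field of the generator `∂/∂θ` of the Lie algebra of
`S¹ = ℝ / ℤ`: the velocity at `θ = 0` of `θ ↦ e^{2πiθ} • x`. -/
def fundamentalVector (x : M) : TangentSpace I x :=
  (mfderiv 𝓘(ℝ, ℝ) I (fun θ : ℝ => Circle.exp (2 * Real.pi * θ) • x) 0 (1 : ℝ) : E)

variable {I}

/-- `α` is a normalized connection form: a smooth `S¹`-invariant `1`-form which takes the value `1`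
on the fundamental vector field of `∂/∂θ`. -/
structure IsNormalizedConnection (α : DForm I M 1) : Prop where
  smooth : α.IsSmooth
  apply_fundamentalVector : ∀ x, α x (fun _ => fundamentalVector I x) = 1
  invariant : ∀ (t : Circle) (x : M),
    (α (t • x)).compContinuousLinearMap (mfderiv I I (fun y : M => t • y) x) = α x

end Action

section EulerNumber

variable {E : Type*} [NormedAddCommGroup E] [NormedSpace ℝ E] [FiniteDimensional ℝ E]
  [MeasurableSpace E] [BorelSpace E]
  {H : Type*} [TopologicalSpace H] {I : ModelWithCorners ℝ E H} [I.Boundaryless]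
  {M : Type*} [TopologicalSpace M] [ChartedSpace H M] [IsManifold I ∞ M]
  [T2Space M] [CompactSpace M] [MulAction Circle M]

/-- The Chern number `∫_M α ∧ (dα)ⁿ` computed with the connection form `α`, for `M` of dimension
`2n + 1` oriented by `μ`. -/
def chernNumber {n : ℕ} (h : Module.finrank ℝ E = 1 + 2 * n) (μ : DForm I M (1 + 2 * n))
    (α : DForm I M 1) : ℝ :=
  integral h μ fun x => wedge (α x) (wedgePow (p := 2) (α.d x) n)

/-- `e(M, ψ) = e`, where `ψ` is the given circle action on the `(2n + 1)`-dimensional closed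
manifold `M` oriented by `μ`: normalized connection forms exist, and `e` is the class modulo `ℤ` of
the Chern number `∫_M α ∧ (dα)ⁿ` for each of them. There is at most one such `e`. -/
def HasEulerNumber {n : ℕ} (h : Module.finrank ℝ E = 1 + 2 * n) (μ : DForm I M (1 + 2 * n))
    (e : AddCircle (1 : ℝ)) : Prop :=
  (∃ α : DForm I M 1, IsNormalizedConnection α) ∧
    ∀ α : DForm I M 1, IsNormalizedConnection α → (chernNumber h μ α : AddCircle (1 : ℝ)) = e

end EulerNumber

theorem finrank_prod_eq {d₁ d₂ n : ℕ} (h : d₁ + d₂ = 2 * n + 1) :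
    Module.finrank ℝ (EuclideanSpace ℝ (Fin d₁) × EuclideanSpace ℝ (Fin d₂)) = 1 + 2 * n := by
  rw [Module.finrank_prod, finrank_euclideanSpace_fin, finrank_euclideanSpace_fin, h, add_comm]

end CircleEuler

end

noncomputable section

namespace CircleEuler

/-! ### One-forms on a normed space and their exterior derivative. -/

section ExtDeriv

variable {E : Type*} [NormedAddCommGroup E] [NormedSpace ℝ E]

/-! A pair of fixed points would be a fixed point of the diagonal action, so one of the two factors,
say `N`, carries a fixed-point-free action. Let `β` be a normalized connection form on `N` and `f`
the projection to `N`. Since `f` is equivariant, `α₀ = f^*β` is a normalized connection form on the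
product. The form `α₀ ∧ (dα₀)ⁿ` is pulled back from a manifold of dimension less than `2n + 1`, so
it vanishes identically: any nonzero vector in the kernel of `df` annihilates all its factors
(`wedge_wedgeProd_eq_zero`).

It remains to pass from `α₀` to an arbitrary connection form `α`. Consider products `a ∧ dc₀ ∧ ⋯ ∧
dc_{n-1}` in which `a` and all `c_i` are connection forms. Two facts suffice. First, the head `a`
may be replaced by any other connection form without changing the product: curvatures are horizontal
(`IsNormalizedConnection.d_apply_fundamentalVector`), so the difference is a top-degree form
annihilated by the nonzero fundamental vector (`wedgeExact_eq_of_connections`). Second, by Stokes,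
exchanging `a` with one `c_i` does not change the integral (`integral_wedgeExact_swap`). Alternating
the two moves replaces the factors `dα₀` by `dα` one at a time. Hence the integral is `0` in `ℝ` for
every `α`, not merely an integer.

Existence of `β` comes from averaging over the circle a smooth one-form with value `1` on the
fundamental field; such a form is built from a Euclidean embedding.

Stokes is proved for just this kind of product: after cutting `a` off to a chart, the difference of
the two coefficients is an explicit sum of directional derivatives of functions with compact
support. The algebra behind it is a formula for the product as a signed sum over all permutations
(`wedge_wedgeProd_apply`). -/

theorem ContDiffAt.compContinuousLinearMap_one {F P : Type*} [NormedAddCommGroup F]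
    [NormedSpace ℝ F] [NormedAddCommGroup P] [NormedSpace ℝ P] {m : ℕ∞}
    {w : P → E [⋀^Fin 1]→L[ℝ] ℝ} {g : P → F →L[ℝ] E} {y : P}
    (hw : ContDiffAt ℝ m w y) (hg : ContDiffAt ℝ m g y) :
    ContDiffAt ℝ m (fun z => (w z).compContinuousLinearMap (g z)) y := by
  let e := ContinuousAlternatingMap.ofSubsingletonLIE (𝕜 := ℝ) (E := E) (F := ℝ) (0 : Fin 1)
  let e' := ContinuousAlternatingMap.ofSubsingletonLIE (𝕜 := ℝ) (E := F) (F := ℝ) (0 : Fin 1)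
  -- In degree one an alternating form is a linear functional, and pulling it back is the bilinear
  -- composition of linear maps.
  have h : (fun z => (w z).compContinuousLinearMap (g z)) =
      fun z => e' ((e.symm (w z)).comp (g z)) := by
    funext z
    obtain ⟨l, hl⟩ := e.surjective (w z)
    rw [← hl, e.symm_apply_apply]
    rfl
  rw [h]
  exact e'.contDiff.contDiffAt.comp y ((e.symm.contDiff.contDiffAt.comp y hw).clm_comp hg)

theorem contDiffAt_extDeriv {k : ℕ} {w : E → E [⋀^Fin k]→L[ℝ] ℝ} {y : E}
    (h : ContDiffAt ℝ ∞ w y) : ContDiffAt ℝ ∞ (extDeriv w) y := by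
  have h1 : ContDiffAt ℝ ∞ (fun z =>
      ContinuousAlternatingMap.alternatizeUncurryFinCLM ℝ E ℝ (fderiv ℝ w z)) y :=
    (ContinuousLinearMap.contDiff _).contDiffAt.comp y (h.fderiv_right (m := ∞) (by simp))
  simpa only [ContinuousAlternatingMap.alternatizeUncurryFinCLM_apply] using! h1

theorem extDeriv_one_apply {w : E → E [⋀^Fin 1]→L[ℝ] ℝ} {y : E} (h : DifferentiableAt ℝ w y)
    (v : Fin 2 → E) : extDeriv w y v =
      fderiv ℝ (fun z => w z fun _ => v 1) y (v 0) - fderiv ℝ (fun z => w z fun _ => v 0) y (v 1) := by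
  rw [extDeriv_apply h, Fin.sum_univ_two]
  have h0 : (Fin.removeNth 0 v) = fun _ : Fin 1 => v 1 := by
    ext i; fin_cases i; rfl
  have h1 : (Fin.removeNth 1 v) = fun _ : Fin 1 => v 0 := by
    ext i; fin_cases i; rfl
  rw [h0, h1]
  simp [sub_eq_add_neg]

end ExtDeriv

/-! ### Pullback of forms to normed spaces, change of charts, naturality of `d`. -/

section Pull

open Topology

variable {E : Type*} [NormedAddCommGroup E] [NormedSpace ℝ E]
  {H : Type*} [TopologicalSpace H] {I : ModelWithCorners ℝ E H}
  {M : Type*} [TopologicalSpace M] [ChartedSpace H M]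
  {F : Type*} [NormedAddCommGroup F] [NormedSpace ℝ F]

/-- The pullback of a form on `M` under a map from a normed space to `M`. -/
def DForm.pull {k : ℕ} (f : F → M) (η : DForm I M k) (y : F) : F [⋀^Fin k]→L[ℝ] ℝ :=
  (η (f y)).compContinuousLinearMap (mfderiv 𝓘(ℝ, F) I f y)

/-- Treating chart expressions as pullbacks lets one set of lemmas cover charts, transition maps and
parametrized families. -/
theorem DForm.inChart_eq_pull {k : ℕ} (η : DForm I M k) (x₀ : M) :
    η.inChart x₀ = η.pull (extChartAt I x₀).symm := rfl

theorem DForm.pull_congr {k : ℕ} (η : DForm I M k) {f g : F → M} {y : F} (h : f =ᶠ[𝓝 y] g) :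
    η.pull f y = η.pull g y := by
  have h1 := h.eq_of_nhds
  have h2 : (mfderiv 𝓘(ℝ, F) I f y : F →L[ℝ] E) = mfderiv 𝓘(ℝ, F) I g y := h.mfderiv_eq
  ext v
  -- The tangent spaces at `f y` and `g y` are distinct types until unfolded to `E`; only then can
  -- the base point be rewritten.
  change (η (f y) : E [⋀^Fin k]→L[ℝ] ℝ) (fun i => (mfderiv 𝓘(ℝ, F) I f y : F →L[ℝ] E) (v i)) =
    (η (g y) : E [⋀^Fin k]→L[ℝ] ℝ) (fun i => (mfderiv 𝓘(ℝ, F) I g y : F →L[ℝ] E) (v i))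
  rw [h1, h2]

theorem DForm.pull_apply {k : ℕ} (η : DForm I M k) (f : F → M) (y : F) (v : Fin k → F) :
    η.pull f y v = η (f y) (fun i => mfderiv 𝓘(ℝ, F) I f y (v i)) := rfl

variable [I.Boundaryless] [IsManifold I ∞ M]

set_option linter.unusedSectionVars false

theorem mdifferentiableAt_extChartAt_symm {x₀ : M} {y : E} (hy : y ∈ (extChartAt I x₀).target) :
    MDifferentiableAt 𝓘(ℝ, E) I (extChartAt I x₀).symm y :=
  ((contMDiffOn_extChartAt_symm (n := ∞) x₀).contMDiffAt
    ((isOpen_extChartAt_target x₀).mem_nhds hy)).mdifferentiableAt (by simp)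

theorem mfderiv_extChartAt_symm_apply {x₀ : M} {y : E} (hy : y ∈ (extChartAt I x₀).target)
    (w : E) : (mfderiv 𝓘(ℝ, E) I (extChartAt I x₀).symm y : E →L[ℝ] E)
      ((mfderiv I 𝓘(ℝ, E) (extChartAt I x₀) ((extChartAt I x₀).symm y) : E →L[ℝ] E) w) = w := by
  have h := mfderivWithin_extChartAt_symm_comp_mfderiv_extChartAt (I := I) hy
  rw [I.range_eq_univ, mfderivWithin_univ] at h
  exact congrArg (fun L : E →L[ℝ] E => L w) h

theorem mfderiv_extChartAt_symm_apply' {x₀ x : M} (hx : x ∈ (extChartAt I x₀).source)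
    (w : E) : (mfderiv 𝓘(ℝ, E) I (extChartAt I x₀).symm (extChartAt I x₀ x) : E →L[ℝ] E)
      ((mfderiv I 𝓘(ℝ, E) (extChartAt I x₀) x : E →L[ℝ] E) w) = w := by
  have h := mfderivWithin_extChartAt_symm_comp_mfderiv_extChartAt' (I := I) hx
  rw [I.range_eq_univ, mfderivWithin_univ] at h
  exact congrArg (fun L : E →L[ℝ] E => L w) h

theorem contMDiffAt_extChartAt_symm {x₀ : M} {y : E} (hy : y ∈ (extChartAt I x₀).target) :
    ContMDiffAt 𝓘(ℝ, E) I ∞ (extChartAt I x₀).symm y :=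
  (contMDiffOn_extChartAt_symm (n := ∞) x₀).contMDiffAt
    ((isOpen_extChartAt_target x₀).mem_nhds hy)

/-- Near `y` the map `f` factors through the inverse chart, and the chain rule applies. For `f`
another inverse chart this is the transition rule. -/
theorem DForm.pull_eq_inChart {k : ℕ} (η : DForm I M k) {f : F → M} {y : F} {x₀ : M}
    (hf : MDifferentiableAt 𝓘(ℝ, F) I f y) (hy : f y ∈ (extChartAt I x₀).source) :
    η.pull f y = (η.inChart x₀ (extChartAt I x₀ (f y))).compContinuousLinearMap
      (fderiv ℝ (extChartAt I x₀ ∘ f) y) := by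
  have hφ : MDifferentiableAt I 𝓘(ℝ, E) (extChartAt I x₀) (f y) :=
    mdifferentiableAt_extChartAt (by simpa using hy)
  have hφf := hφ.comp y hf
  have hev : f =ᶠ[𝓝 y] (extChartAt I x₀).symm ∘ (extChartAt I x₀ ∘ f) := by
    filter_upwards [hf.continuousAt.preimage_mem_nhds
      ((isOpen_extChartAt_source (I := I) x₀).mem_nhds hy)] with z hz
    exact ((extChartAt I x₀).left_inv hz).symm
  have hs : MDifferentiableAt 𝓘(ℝ, E) I (extChartAt I x₀).symm ((extChartAt I x₀ ∘ f) y) :=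
    mdifferentiableAt_extChartAt_symm ((extChartAt I x₀).map_source hy)
  rw [DForm.pull_congr η hev]
  ext v
  rw [DForm.pull_apply, mfderiv_comp y hs hφf, mfderiv_eq_fderiv]
  rfl

theorem DForm.IsSmooth.contDiffAt_inChart {k : ℕ} {η : DForm I M k} (hη : η.IsSmooth) {x₀ : M}
    {y : E} (hy : y ∈ (extChartAt I x₀).target) : ContDiffAt ℝ ∞ (η.inChart x₀) y :=
  (hη x₀).contDiffAt ((isOpen_extChartAt_target x₀).mem_nhds hy)

theorem DForm.isSmooth_of_contDiffAt {k : ℕ} {η : DForm I M k}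
    (h : ∀ x₀ : M, ∀ y ∈ (extChartAt I x₀).target, ContDiffAt ℝ ∞ (η.inChart x₀) y) :
    η.IsSmooth := fun x₀ y hy => (h x₀ y hy).contDiffWithinAt

omit [I.Boundaryless] in
theorem contDiffAt_extChartAt_comp {f : F → M} {y : F} {x₀ : M}
    (hf : ContMDiffAt 𝓘(ℝ, F) I ∞ f y) (hy : f y ∈ (extChartAt I x₀).source) :
    ContDiffAt ℝ ∞ (extChartAt I x₀ ∘ f) y :=
  ((contMDiffAt_extChartAt' (by simpa using hy)).comp y hf).contDiffAt

omit [I.Boundaryless] in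
theorem eventually_contMDiffAt {f : F → M} {y : F}
    (hf : ContMDiffAt 𝓘(ℝ, F) I ∞ f y) : ∀ᶠ z in 𝓝 y, ContMDiffAt 𝓘(ℝ, F) I 1 f z := by
  exact (contMDiffAt_iff_contMDiffAt_nhds (by simp)).1 (hf.of_le (by simp))

theorem DForm.pull_eventuallyEq {k : ℕ} (η : DForm I M k) {f : F → M} {y : F} {x₀ : M}
    (hf : ContMDiffAt 𝓘(ℝ, F) I ∞ f y) (hy : f y ∈ (extChartAt I x₀).source) :
    η.pull f =ᶠ[𝓝 y] fun z => (η.inChart x₀ ((extChartAt I x₀ ∘ f) z)).compContinuousLinearMap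
      (fderiv ℝ (extChartAt I x₀ ∘ f) z) := by
  filter_upwards [eventually_contMDiffAt hf, hf.continuousAt.preimage_mem_nhds
    ((isOpen_extChartAt_source (I := I) x₀).mem_nhds hy)] with z hz hz'
  exact η.pull_eq_inChart (hz.mdifferentiableAt (by simp)) hz'

theorem DForm.IsSmooth.contDiffAt_pull {η : DForm I M 1} (hη : η.IsSmooth) {f : F → M}
    {y : F} (hf : ContMDiffAt 𝓘(ℝ, F) I ∞ f y) : ContDiffAt ℝ ∞ (η.pull f) y := by
  have hs := mem_extChartAt_source (I := I) (f y)
  refine ContDiffAt.congr_of_eventuallyEq ?_ (η.pull_eventuallyEq hf hs)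
  have h1 := contDiffAt_extChartAt_comp hf hs
  have h2 : ContDiffAt ℝ ∞ (fun z => η.inChart (f y) ((extChartAt I (f y) ∘ f) z)) y :=
    (hη.contDiffAt_inChart ((extChartAt I (f y)).map_source hs)).comp
      (f := extChartAt I (f y) ∘ f) y h1
  exact ContDiffAt.compContinuousLinearMap_one h2 (h1.fderiv_right (by simp))

/-- In the chart at `f y`, which is the one that defines `η.d`, this becomes naturality of
`extDeriv` under maps of normed spaces. -/
theorem DForm.IsSmooth.extDeriv_pull {k : ℕ} {η : DForm I M k} (hη : η.IsSmooth) {f : F → M}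
    {y : F} (hf : ContMDiffAt 𝓘(ℝ, F) I ∞ f y) : extDeriv (η.pull f) y = η.d.pull f y := by
  have hs := mem_extChartAt_source (I := I) (f y)
  rw [(η.pull_eventuallyEq hf hs).extDeriv_eq]
  have h1 := contDiffAt_extChartAt_comp hf hs
  rw [_root_.extDeriv_pullback (f := extChartAt I (f y) ∘ f) (r := ∞)
    ((hη.contDiffAt_inChart ((extChartAt I (f y)).map_source hs)).differentiableAt (by simp)) h1
    (by simpa using ENat.LEInfty.out)]
  ext v
  rw [DForm.pull_apply, DForm.d, ← mfderiv_eq_fderiv, mfderiv_comp y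
    (mdifferentiableAt_extChartAt (by simp)) (hf.mdifferentiableAt (by simp))]
  rfl

/-- Independence of the chart: `η.d` is defined through a different chart at each point, yet any
single chart computes it. -/
theorem DForm.IsSmooth.inChart_d {k : ℕ} {η : DForm I M k} (hη : η.IsSmooth) {x₀ : M}
    {y : E} (hy : y ∈ (extChartAt I x₀).target) :
    η.d.inChart x₀ y = extDeriv (η.inChart x₀) y :=
  (hη.extDeriv_pull (contMDiffAt_extChartAt_symm hy)).symm

omit [I.Boundaryless] [IsManifold I ∞ M] in
theorem DForm.pull_comp {k : ℕ} (η : DForm I M k) {G : Type*} [NormedAddCommGroup G]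
    [NormedSpace ℝ G] {f : F → M} {g : G → F} {z : G}
    (hf : MDifferentiableAt 𝓘(ℝ, F) I f (g z)) (hg : DifferentiableAt ℝ g z) :
    η.pull (f ∘ g) z = (η.pull f (g z)).compContinuousLinearMap (fderiv ℝ g z) := by
  ext v
  rw [DForm.pull_apply, mfderiv_comp z hf hg.mdifferentiableAt, mfderiv_eq_fderiv]
  rfl

end Pull

/-! ### Pullback of forms under maps of manifolds. -/

section Pullback

variable {E : Type*} [NormedAddCommGroup E] [NormedSpace ℝ E]
  {H : Type*} [TopologicalSpace H] {I : ModelWithCorners ℝ E H} [I.Boundaryless]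
  {M : Type*} [TopologicalSpace M] [ChartedSpace H M] [IsManifold I ∞ M]
  {E' : Type*} [NormedAddCommGroup E'] [NormedSpace ℝ E']
  {H' : Type*} [TopologicalSpace H'] {J : ModelWithCorners ℝ E' H'} [J.Boundaryless]
  {N : Type*} [TopologicalSpace N] [ChartedSpace H' N] [IsManifold J ∞ N]
  {F : Type*} [NormedAddCommGroup F] [NormedSpace ℝ F]

variable (I) in
/-- The pullback of a form under a map of manifolds. -/
def DForm.pullback {k : ℕ} (f : M → N) (η : DForm J N k) : DForm I M k := fun x =>
  (η (f x)).compContinuousLinearMap (mfderiv I J f x)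

omit [I.Boundaryless] [J.Boundaryless] [IsManifold I ∞ M] [IsManifold J ∞ N] in
theorem DForm.pull_pullback {k : ℕ} (η : DForm J N k) {f : M → N} {g : F → M} {y : F}
    (hf : MDifferentiableAt I J f (g y)) (hg : MDifferentiableAt 𝓘(ℝ, F) I g y) :
    (η.pullback I f).pull g y = η.pull (f ∘ g) y := by
  ext v
  rw [DForm.pull_apply, DForm.pull_apply, mfderiv_comp y hf hg]
  rfl

theorem DForm.IsSmooth.pullback {η : DForm J N 1} (hη : η.IsSmooth) {f : M → N}
    (hf : ContMDiff I J ∞ f) : (η.pullback I f).IsSmooth :=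
  DForm.isSmooth_of_contDiffAt fun x₀ y hy => by
    have h := hη.contDiffAt_pull ((hf _).comp y (contMDiffAt_extChartAt_symm (I := I) hy))
    refine h.congr_of_eventuallyEq ?_
    filter_upwards [(isOpen_extChartAt_target x₀).mem_nhds hy] with z hz
    exact η.pull_pullback (hf.mdifferentiableAt (by simp)) (mdifferentiableAt_extChartAt_symm hz)

theorem DForm.IsSmooth.d_pullback {η : DForm J N 1} (hη : η.IsSmooth) {f : M → N}
    (hf : ContMDiff I J ∞ f) : (η.pullback I f).d = η.d.pullback I f := by
  funext x
  have hx := mem_extChartAt_target (I := I) x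
  have h1 : (η.pullback I f).inChart x =ᶠ[nhds (extChartAt I x x)]
      η.pull (f ∘ (extChartAt I x).symm) := by
    filter_upwards [(isOpen_extChartAt_target x).mem_nhds hx] with z hz
    exact η.pull_pullback (hf.mdifferentiableAt (by simp)) (mdifferentiableAt_extChartAt_symm hz)
  rw [DForm.d, h1.extDeriv_eq, hη.extDeriv_pull
    ((hf _).comp (extChartAt I x x) (contMDiffAt_extChartAt_symm hx)),
    ← DForm.pull_pullback η.d (hf.mdifferentiableAt (by simp))
      (mdifferentiableAt_extChartAt_symm hx)]
  ext v
  have key : ∀ x', x' = x → ∀ w w' : Fin 2 → E, w = w' →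
      (η.d.pullback I f x' : E [⋀^Fin 2]→L[ℝ] ℝ) w = (η.d.pullback I f x : E [⋀^Fin 2]→L[ℝ] ℝ) w' := by
    rintro _ rfl _ _ rfl; rfl
  exact key _ (extChartAt_to_inv x) _ _ (funext fun i =>
    mfderiv_extChartAt_symm_apply' (I := I) (E := E) (mem_extChartAt_source x) (v i))

end Pullback

/-! ### Wedge products as signed sums over permutations. -/

section WedgeFormula

variable {V : Type*} [AddCommGroup V] [Module ℝ V]

theorem alternatization_domDomCongr {ι ι' : Type*} [Fintype ι] [DecidableEq ι] [Fintype ι']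
    [DecidableEq ι'] (e : ι ≃ ι') (m : MultilinearMap ℝ (fun _ : ι => V) ℝ) :
    (m.domDomCongr e).alternatization = m.alternatization.domDomCongr e := by
  ext v
  simp only [MultilinearMap.alternatization_apply, AlternatingMap.domDomCongr_apply,
    MultilinearMap.domDomCongr_apply]
  refine (Fintype.sum_equiv e.permCongr _ _ fun σ => ?_).symm
  rw [Equiv.Perm.sign_permCongr]
  simp

/-- The product `m₁(v₁, …, v_p) m₂(v_{p+1}, …, v_{p+q})` of multilinear forms. -/
def tensorForm {p q : ℕ} (m₁ : MultilinearMap ℝ (fun _ : Fin p => V) ℝ)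
    (m₂ : MultilinearMap ℝ (fun _ : Fin q => V) ℝ) :
    MultilinearMap ℝ (fun _ : Fin (p + q) => V) ℝ :=
  ((LinearMap.mul' ℝ ℝ).compMultilinearMap (m₁.domCoprod m₂)).domDomCongr finSumFinEquiv

theorem tensorForm_apply {p q : ℕ} (m₁ : MultilinearMap ℝ (fun _ : Fin p => V) ℝ)
    (m₂ : MultilinearMap ℝ (fun _ : Fin q => V) ℝ) (v : Fin (p + q) → V) :
    tensorForm m₁ m₂ v = m₁ (fun i => v (Fin.castAdd q i)) * m₂ (fun i => v (Fin.natAdd p i)) := by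
  simp [tensorForm]

variable [TopologicalSpace V]

/-- The shuffle product of two alternatizations is the alternatization of the tensor product. With
factors presented in this way, the quotient by block permutations disappears. -/
theorem wedge_eq_alternatization {p q : ℕ} {a : V [⋀^Fin p]→L[ℝ] ℝ} {b : V [⋀^Fin q]→L[ℝ] ℝ}
    {m₁ : MultilinearMap ℝ (fun _ : Fin p => V) ℝ} {m₂ : MultilinearMap ℝ (fun _ : Fin q => V) ℝ}
    (ha : a.toAlternatingMap = m₁.alternatization) (hb : b.toAlternatingMap = m₂.alternatization) :
    (wedge a b).toAlternatingMap = (tensorForm m₁ m₂).alternatization := by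
  rw [tensorForm, alternatization_domDomCongr, LinearMap.compMultilinearMap_alternatization,
    MultilinearMap.domCoprod_alternization, ← ha, ← hb]
  rfl

/-- The product `A₀ ∧ ⋯ ∧ A_{n-1}` of two-forms. -/
def wedgeProd : {n : ℕ} → (Fin n → V [⋀^Fin 2]→L[ℝ] ℝ) → V [⋀^Fin (2 * n)]→L[ℝ] ℝ
  | 0, _ => ContinuousAlternatingMap.constOfIsEmpty ℝ V (Fin 0) 1
  | n + 1, A => wedge (wedgeProd fun i : Fin n => A i.castSucc) (A (Fin.last n))

theorem wedgePow_eq_wedgeProd (a : V [⋀^Fin 2]→L[ℝ] ℝ) (n : ℕ) :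
    wedgePow a n = wedgeProd fun _ : Fin n => a := by
  induction n with
  | zero => rfl
  | succ n ih => rw [wedgePow, wedgeProd, ih]

/-- A two-form is the alternatization of half of itself, whence the power of `1 / 2`. The induction
has to carry the multilinear form together with its values. -/
theorem exists_wedgeProd_eq_alternatization {n : ℕ} (A : Fin n → V [⋀^Fin 2]→L[ℝ] ℝ) :
    ∃ m : MultilinearMap ℝ (fun _ : Fin (2 * n) => V) ℝ,
      (wedgeProd A).toAlternatingMap = m.alternatization ∧
      ∀ v, m v = (1 / 2) ^ n *
        ∏ i : Fin n, A i ![v ⟨2 * i, by omega⟩, v ⟨2 * i + 1, by omega⟩] := by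
  induction n with
  | zero =>
    refine ⟨(wedgeProd A).toMultilinearMap, ?_, fun v => by simp [wedgeProd]⟩
    ext v
    have : Subsingleton (Equiv.Perm (Fin (2 * 0))) :=
      inferInstanceAs (Subsingleton (Equiv.Perm (Fin 0)))
    rw [MultilinearMap.alternatization_apply, Fintype.sum_subsingleton _ 1]
    simp [wedgeProd]
  | succ n ih =>
    obtain ⟨m, hm, hmv⟩ := ih fun i : Fin n => A i.castSucc
    refine ⟨tensorForm m ((1 / 2 : ℝ) • (A (Fin.last n)).toMultilinearMap),
      wedge_eq_alternatization hm ?_, fun v => ?_⟩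
    · ext v
      have h := AlternatingMap.coe_alternatization (A (Fin.last n)).toAlternatingMap
      have h' := congrArg (fun f => f v) h
      rw [MultilinearMap.alternatization_apply] at h' ⊢
      simp only [MultilinearMap.domDomCongr_apply, smul_apply, smul_comm _ (1 / 2 : ℝ)] at h' ⊢
      rw [← Finset.smul_sum]
      refine Eq.trans ?_ (congrArg (fun x : ℝ => (1 / 2 : ℝ) • x) h').symm
      simp
    · rw [tensorForm_apply, hmv, Fin.prod_univ_castSucc]
      have h2 : (fun i : Fin 2 => v (Fin.natAdd (2 * n) i)) =
          ![v ⟨2 * (Fin.last n : Fin (n + 1)), by simp⟩,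
            v ⟨2 * (Fin.last n : Fin (n + 1)) + 1, by simp; omega⟩] := by
        ext i; fin_cases i <;> rfl
      have h3 : ((1 / 2 : ℝ) • (A (Fin.last n)).toMultilinearMap)
          (fun i : Fin 2 => v (Fin.natAdd (2 * n) i)) = (1 / 2 : ℝ) * A (Fin.last n)
            ![v ⟨2 * (Fin.last n : Fin (n + 1)), by simp⟩,
            v ⟨2 * (Fin.last n : Fin (n + 1)) + 1, by simp; omega⟩] := by
        rw [h2]; rfl
      refine (congrArg (_ * ·) h3).trans ?_
      rw [pow_succ]
      simp only [Fin.castAdd_mk, Fin.val_castSucc]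
      ring

/-- The position of the argument of the one-form in `a ∧ A₀ ∧ ⋯ ∧ A_{n-1}`. -/
def headIdx (n : ℕ) : Fin (1 + 2 * n) := ⟨0, by omega⟩

/-- The position of the first argument of `A i` in `a ∧ A₀ ∧ ⋯ ∧ A_{n-1}`. -/
def fstIdx {n : ℕ} (i : Fin n) : Fin (1 + 2 * n) := ⟨1 + 2 * i, by omega⟩

/-- The position of the second argument of `A i` in `a ∧ A₀ ∧ ⋯ ∧ A_{n-1}`. -/
def sndIdx {n : ℕ} (i : Fin n) : Fin (1 + 2 * n) := ⟨1 + (2 * i + 1), by omega⟩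

/-- The working formula for all later algebra: summing over the full symmetric group counts each
pair of arguments in both orders, which `(1 / 2) ^ n` corrects. -/
theorem wedge_wedgeProd_apply {n : ℕ} (a : V [⋀^Fin 1]→L[ℝ] ℝ) (A : Fin n → V [⋀^Fin 2]→L[ℝ] ℝ)
    (v : Fin (1 + 2 * n) → V) :
    wedge a (wedgeProd A) v = (1 / 2) ^ n * ∑ σ : Equiv.Perm (Fin (1 + 2 * n)),
      (Equiv.Perm.sign σ : ℤ) * ((a fun _ => v (σ (headIdx n))) *
        ∏ i, A i ![v (σ (fstIdx i)), v (σ (sndIdx i))]) := by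
  obtain ⟨m, hm, hmv⟩ := exists_wedgeProd_eq_alternatization A
  have ha : a.toAlternatingMap = MultilinearMap.alternatization a.toMultilinearMap := by
    ext w
    rw [MultilinearMap.alternatization_apply, Fintype.sum_unique]
    simp
  have h := congrArg (fun f => f v) (wedge_eq_alternatization ha hm)
  refine Eq.trans h ?_
  simp only [MultilinearMap.alternatization_apply, MultilinearMap.domDomCongr_apply,
    tensorForm_apply, hmv, Finset.mul_sum]
  refine Finset.sum_congr rfl fun σ _ => ?_
  have h1 : (a.toMultilinearMap fun i : Fin 1 => v (σ (Fin.castAdd (2 * n) i))) =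
      a fun _ => v (σ (headIdx n)) := by
    change a _ = _
    congr 1
    ext i; fin_cases i; rfl
  rw [h1, Units.smul_def, zsmul_eq_mul]
  simp only [Fin.natAdd_mk, fstIdx, sndIdx]
  ring

theorem wedge_wedgeProd_sub {n : ℕ} (a a' : V [⋀^Fin 1]→L[ℝ] ℝ)
    (A : Fin n → V [⋀^Fin 2]→L[ℝ] ℝ) (v : Fin (1 + 2 * n) → V) (b : V [⋀^Fin 1]→L[ℝ] ℝ)
    (h : ∀ w, b w = a w - a' w) :
    wedge b (wedgeProd A) v = wedge a (wedgeProd A) v - wedge a' (wedgeProd A) v := by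
  simp only [wedge_wedgeProd_apply, h, ← mul_sub, ← Finset.sum_sub_distrib]
  exact congrArg _ (Finset.sum_congr rfl fun σ _ => by ring)

theorem wedge_wedgeProd_comp {W : Type*} [AddCommGroup W] [Module ℝ W] [TopologicalSpace W] {n : ℕ}
    (a : V [⋀^Fin 1]→L[ℝ] ℝ) (A : Fin n → V [⋀^Fin 2]→L[ℝ] ℝ) (f : W →L[ℝ] V) :
    (wedge a (wedgeProd A)).compContinuousLinearMap f =
      wedge (a.compContinuousLinearMap f)
        (wedgeProd fun i => (A i).compContinuousLinearMap f) := by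
  ext v
  rw [ContinuousAlternatingMap.compContinuousLinearMap_apply, wedge_wedgeProd_apply,
    wedge_wedgeProd_apply]
  congr 1
  refine Finset.sum_congr rfl fun σ _ => ?_
  congr 2
  refine Finset.prod_congr rfl fun i _ => ?_
  rw [ContinuousAlternatingMap.compContinuousLinearMap_apply]
  congr 1
  ext j; fin_cases j <;> rfl

theorem forall_index_cases {n : ℕ} (k : Fin (1 + 2 * n)) :
    k = headIdx n ∨ ∃ i, k = fstIdx i ∨ k = sndIdx i := by
  rcases k with ⟨k, hk⟩
  rcases Nat.eq_zero_or_pos k with rfl | h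
  · exact Or.inl rfl
  · refine Or.inr ⟨⟨(k - 1) / 2, by omega⟩, ?_⟩
    simp only [fstIdx, sndIdx, Fin.mk.injEq]
    omega

/-- A product of top degree vanishes if all factors are annihilated by a nonzero vector. -/
theorem wedge_wedgeProd_eq_zero {n : ℕ} (b : Module.Basis (Fin (1 + 2 * n)) ℝ V)
    {a : V [⋀^Fin 1]→L[ℝ] ℝ} {A : Fin n → V [⋀^Fin 2]→L[ℝ] ℝ} {Y : V} (hY : Y ≠ 0)
    (ha : (a fun _ => Y) = 0) (hA : ∀ i w, A i ![Y, w] = 0) : wedge a (wedgeProd A) = 0 := by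
  have hA' : ∀ i w, A i ![w, Y] = 0 := fun i w => by
    have h := (A i).toAlternatingMap.map_swap ![Y, w] (i := 0) (j := 1) (by decide)
    have h1 : ![Y, w] ∘ Equiv.swap (0 : Fin 2) 1 = ![w, Y] := by
      ext j; fin_cases j <;> rfl
    rw [h1] at h
    have h2 : (A i).toAlternatingMap ![Y, w] = 0 := hA i w
    rw [h2, neg_zero] at h
    exact h
  -- In each term of the permutation sum, `Y` is an argument of exactly one factor, which then
  -- vanishes.
  have hzero : ∀ (v : Fin (1 + 2 * n) → V) (k), v k = Y → wedge a (wedgeProd A) v = 0 := by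
    intro v k hk
    rw [wedge_wedgeProd_apply, Finset.sum_eq_zero, mul_zero]
    intro σ _
    rcases forall_index_cases (σ.symm k) with h | ⟨i, h | h⟩
    · rw [← h, σ.apply_symm_apply, hk, ha, zero_mul, mul_zero]
    · rw [Finset.prod_eq_zero (Finset.mem_univ i), mul_zero, mul_zero]
      rw [← h, σ.apply_symm_apply, hk, hA]
    · rw [Finset.prod_eq_zero (Finset.mem_univ i), mul_zero, mul_zero]
      rw [← h, σ.apply_symm_apply, hk, hA']
  obtain ⟨k, hk⟩ : ∃ k, b.repr Y k ≠ 0 := by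
    by_contra! h
    exact hY (b.repr.map_eq_zero_iff.1 (Finsupp.ext h))
  -- Replacing `b k` by `Y` multiplies the value on the basis by the nonzero coordinate of `Y` at
  -- `k`.
  have hb : wedge a (wedgeProd A) b = 0 := by
    have h0 := hzero (Function.update b k Y) k (by simp)
    have h1 : (wedge a (wedgeProd A)).toAlternatingMap
        (Function.update b k (∑ j, b.repr Y j • b j)) = 0 := by rw [b.sum_repr]; exact h0
    rw [AlternatingMap.map_update_sum, Finset.sum_eq_single k] at h1
    · rw [AlternatingMap.map_update_smul, Function.update_eq_self] at h1
      exact (smul_eq_zero.1 h1).resolve_left hk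
    · intro j _ hj
      rw [AlternatingMap.map_update_smul, AlternatingMap.map_update_self _ _ hj.symm, smul_zero]
    · simp
  have h : (wedge a (wedgeProd A)).toAlternatingMap = 0 := by
    refine Module.Basis.ext_alternating b fun v hv => ?_
    obtain ⟨σ, hσ⟩ : ∃ σ : Equiv.Perm (Fin (1 + 2 * n)), v = σ :=
      ⟨Equiv.ofBijective v (Finite.injective_iff_bijective.1 hv), rfl⟩
    have := (wedge a (wedgeProd A)).toAlternatingMap.map_perm b σ
    rw [hσ]
    refine this.trans ?_
    change _ • wedge a (wedgeProd A) b = _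
    rw [hb, smul_zero]; rfl
  ext v
  exact congrArg (fun f => f v) h

end WedgeFormula

/-! ### Argument positions and transpositions in signed sums. -/

section SignedSums

variable {n : ℕ}

@[simp] theorem fstIdx_inj {i j : Fin n} : fstIdx i = fstIdx j ↔ i = j := by
  simp only [fstIdx, Fin.ext_iff]; omega

@[simp] theorem sndIdx_inj {i j : Fin n} : sndIdx i = sndIdx j ↔ i = j := by
  simp only [sndIdx, Fin.ext_iff]; omega

@[simp] theorem fstIdx_ne_sndIdx (i j : Fin n) : fstIdx i ≠ sndIdx j := by
  simp only [fstIdx, sndIdx, ne_eq, Fin.mk.injEq]; omega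

@[simp] theorem sndIdx_ne_fstIdx (i j : Fin n) : sndIdx i ≠ fstIdx j :=
  (fstIdx_ne_sndIdx j i).symm

@[simp] theorem fstIdx_ne_headIdx (i : Fin n) : fstIdx i ≠ headIdx n := by
  simp only [fstIdx, headIdx, ne_eq, Fin.mk.injEq]; omega

@[simp] theorem sndIdx_ne_headIdx (i : Fin n) : sndIdx i ≠ headIdx n := by
  simp only [sndIdx, headIdx, ne_eq, Fin.mk.injEq]; omega

@[simp] theorem headIdx_ne_fstIdx (i : Fin n) : headIdx n ≠ fstIdx i := (fstIdx_ne_headIdx i).symm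

@[simp] theorem headIdx_ne_sndIdx (i : Fin n) : headIdx n ≠ sndIdx i := (sndIdx_ne_headIdx i).symm

variable {κ : Type*} [Fintype κ] [DecidableEq κ]

/-- Right multiplication by a transposition exchanges two argument positions and reverses the sign.
-/
theorem sum_sign_mul_swap {i j : κ} (hij : i ≠ j) (f : Equiv.Perm κ → ℝ) :
    ∑ σ, (Equiv.Perm.sign σ : ℤ) * f (σ * Equiv.swap i j) =
      -∑ σ, (Equiv.Perm.sign σ : ℤ) * f σ := by
  rw [← Finset.sum_neg_distrib]
  refine Fintype.sum_equiv (Equiv.mulRight (Equiv.swap i j)) _ _ fun σ => ?_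
  simp [Equiv.Perm.sign_mul, Equiv.Perm.sign_swap hij]

theorem sum_sign_mul_eq_zero {i j : κ} (hij : i ≠ j) {f : Equiv.Perm κ → ℝ}
    (h : ∀ σ, f (σ * Equiv.swap i j) = f σ) : ∑ σ, (Equiv.Perm.sign σ : ℤ) * f σ = 0 := by
  have := sum_sign_mul_swap hij f
  simp only [h] at this
  linarith

end SignedSums

/-! ### The pointwise identity behind Stokes' theorem. -/

section Divergence

variable {E : Type*} [NormedAddCommGroup E] [NormedSpace ℝ E] {n : ℕ}

/-- Brings out the second derivatives whose symmetry is responsible for `d(dc) = 0`. -/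
theorem fderiv_extDeriv_one_apply {c : E → E [⋀^Fin 1]→L[ℝ] ℝ} {y : E} (hc : ContDiffAt ℝ ∞ c y)
    (u w w' : E) : fderiv ℝ (fun z => extDeriv c z ![w, w']) y u =
      fderiv ℝ (fderiv ℝ fun z => c z fun _ => w') y u w -
        fderiv ℝ (fderiv ℝ fun z => c z fun _ => w) y u w' := by
  have hap : ∀ w : E, ContDiffAt ℝ ∞ (fun z => c z fun _ => w) y := fun w =>
    ((ContinuousAlternatingMap.apply ℝ E ℝ (fun _ : Fin 1 => w)).contDiff.contDiffAt.comp y hc)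
  have hd : ∀ w u : E, DifferentiableAt ℝ (fun z => fderiv ℝ (fun z => c z fun _ => w) z u) y :=
    fun w u => (((hap w).fderiv_right (m := 1)
      (by norm_num; exact ENat.LEInfty.out)).differentiableAt (by simp)).clm_apply
      (differentiableAt_const u)
  have hd' : ∀ w : E, DifferentiableAt ℝ (fderiv ℝ (fun z => c z fun _ => w)) y :=
    fun w => ((hap w).fderiv_right (m := 1)
      (by norm_num; exact ENat.LEInfty.out)).differentiableAt (by simp)
  have hev : (fun z => extDeriv c z ![w, w']) =ᶠ[nhds y] fun z =>
      fderiv ℝ (fun z => c z fun _ => w') z w - fderiv ℝ (fun z => c z fun _ => w) z w' := by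
    filter_upwards [(hc.of_le (m := 1) (by simp)).eventually (by simp)] with z hz
    exact extDeriv_one_apply (hz.differentiableAt (by simp)) _
  rw [hev.fderiv_eq, fderiv_fun_sub (hd _ _) (hd _ _)]
  rw [sub_apply, fderiv_clm_apply (hd' _) (differentiableAt_const _),
    fderiv_clm_apply (hd' _) (differentiableAt_const _)]
  simp

/-- The coefficients of `a ∧ dc₀ ∧ ⋯ ∧ dc_{n-1}` and `c_{i₀} ∧ dc₀ ∧ ⋯ ∧ da ∧ ⋯ ∧ dc_{n-1}` differ
by a divergence. -/
theorem wedge_extDeriv_sub_swap {a : E → E [⋀^Fin 1]→L[ℝ] ℝ}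
    {c : Fin n → E → E [⋀^Fin 1]→L[ℝ] ℝ} {y : E} (ha : ContDiffAt ℝ ∞ a y)
    (hc : ∀ i, ContDiffAt ℝ ∞ (c i) y) (i₀ : Fin n) (v : Fin (1 + 2 * n) → E) :
    wedge (a y) (wedgeProd fun i => extDeriv (c i) y) v -
      wedge (c i₀ y) (wedgeProd fun i => extDeriv (Function.update c i₀ a i) y) v =
    2 * (1 / 2) ^ n * ∑ σ : Equiv.Perm (Fin (1 + 2 * n)), (Equiv.Perm.sign σ : ℤ) *
      fderiv ℝ (fun z => ((a z fun _ => v (σ (headIdx n))) * (c i₀ z fun _ => v (σ (sndIdx i₀)))) *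
        ∏ i ∈ Finset.univ.erase i₀, extDeriv (c i) z ![v (σ (fstIdx i)), v (σ (sndIdx i))]) y
          (v (σ (fstIdx i₀))) := by
  have hap : ∀ {b : E → E [⋀^Fin 1]→L[ℝ] ℝ} (_ : ContDiffAt ℝ ∞ b y) (w : E),
      ContDiffAt ℝ ∞ (fun z => b z fun _ => w) y := fun hb w =>
    ((ContinuousAlternatingMap.apply ℝ E ℝ (fun _ : Fin 1 => w)).contDiff.contDiffAt.comp y hb)
  have hdap : ∀ {b : E → E [⋀^Fin 1]→L[ℝ] ℝ} (_ : ContDiffAt ℝ ∞ b y) (w : E),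
      DifferentiableAt ℝ (fun z => b z fun _ => w) y := fun hb w =>
    (hap hb w).differentiableAt (by simp)
  have hde : ∀ i (w : Fin 2 → E), DifferentiableAt ℝ (fun z => extDeriv (c i) z w) y :=
    fun i w => ((ContinuousAlternatingMap.apply ℝ E ℝ w).contDiff.contDiffAt.comp y
      (contDiffAt_extDeriv (hc i))).differentiableAt (by simp)
  set R : Equiv.Perm (Fin (1 + 2 * n)) → ℝ := fun σ =>
    ∏ i ∈ Finset.univ.erase i₀, extDeriv (c i) y ![v (σ (fstIdx i)), v (σ (sndIdx i))] with hR
  -- The remaining factors `R` use none of the positions of the head and of slot `i₀`.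
  have hRswap : ∀ σ k l, (k = headIdx n ∨ k = fstIdx i₀) → (l = sndIdx i₀) →
      R (σ * Equiv.swap k l) = R σ := by
    intro σ k l hk hl
    refine Finset.prod_congr rfl fun i hi => ?_
    have hi' : i ≠ i₀ := Finset.ne_of_mem_erase hi
    have h1 : Equiv.swap k l (fstIdx i) = fstIdx i := by
      apply Equiv.swap_apply_of_ne_of_ne <;> rcases hk with rfl | rfl <;> simp [hl, hi']
    have h2 : Equiv.swap k l (sndIdx i) = sndIdx i := by
      apply Equiv.swap_apply_of_ne_of_ne <;> rcases hk with rfl | rfl <;> simp [hl, hi']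
    simp only [Equiv.Perm.mul_apply, h1, h2]
  -- the part of the sum in which one form is differentiated
  have hpart : ∀ {b b' : E → E [⋀^Fin 1]→L[ℝ] ℝ}, ContDiffAt ℝ ∞ b' y →
      ∑ σ : Equiv.Perm (Fin (1 + 2 * n)), (Equiv.Perm.sign σ : ℤ) *
        ((b y fun _ => v (σ (headIdx n))) *
          (extDeriv b' y ![v (σ (fstIdx i₀)), v (σ (sndIdx i₀))] * R σ)) =
      2 * ∑ σ : Equiv.Perm (Fin (1 + 2 * n)), (Equiv.Perm.sign σ : ℤ) *
        ((b y fun _ => v (σ (headIdx n))) *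
          (fderiv ℝ (fun z => b' z fun _ => v (σ (sndIdx i₀))) y (v (σ (fstIdx i₀))) * R σ)) := by
    intro b b' hb'
    -- The two terms of `db'` are interchanged, up to sign, by transposing the two positions of slot
    -- `i₀`, so they contribute equally. This is the factor `2`.
    have h := sum_sign_mul_swap (fstIdx_ne_sndIdx i₀ i₀) fun σ : Equiv.Perm (Fin (1 + 2 * n)) =>
      ((b y fun _ => v (σ (headIdx n))) *
          (fderiv ℝ (fun z => b' z fun _ => v (σ (sndIdx i₀))) y (v (σ (fstIdx i₀))) * R σ))
    have h0 : Equiv.swap (fstIdx i₀) (sndIdx i₀) (headIdx n) = headIdx n :=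
      Equiv.swap_apply_of_ne_of_ne (by simp) (by simp)
    simp only [hRswap _ _ _ (Or.inr rfl) rfl, Equiv.Perm.mul_apply, h0, Equiv.swap_apply_left,
      Equiv.swap_apply_right] at h
    have h2 := congrArg (fun x => -x) h
    simp only [neg_neg] at h2
    refine Eq.trans ?_ ((congrArg (· + _) h2).trans (two_mul _).symm)
    rw [← Finset.sum_neg_distrib, ← Finset.sum_add_distrib]
    refine Finset.sum_congr rfl fun σ _ => ?_
    rw [extDeriv_one_apply (hb'.differentiableAt (by simp))]
    simp only [Matrix.cons_val_zero, Matrix.cons_val_one]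
    ring
  have hfirst : wedge (a y) (wedgeProd fun i => extDeriv (c i) y) v = (1 / 2) ^ n *
      ∑ σ : Equiv.Perm (Fin (1 + 2 * n)), (Equiv.Perm.sign σ : ℤ) *
        ((a y fun _ => v (σ (headIdx n))) *
          (extDeriv (c i₀) y ![v (σ (fstIdx i₀)), v (σ (sndIdx i₀))] * R σ)) := by
    rw [wedge_wedgeProd_apply]
    congr 1
    refine Finset.sum_congr rfl fun σ _ => ?_
    rw [← Finset.mul_prod_erase _ _ (Finset.mem_univ i₀)]
  have hsecond : wedge (c i₀ y) (wedgeProd fun i => extDeriv (Function.update c i₀ a i) y) v =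
      (1 / 2) ^ n * ∑ σ : Equiv.Perm (Fin (1 + 2 * n)), (Equiv.Perm.sign σ : ℤ) *
        ((c i₀ y fun _ => v (σ (headIdx n))) *
          (extDeriv a y ![v (σ (fstIdx i₀)), v (σ (sndIdx i₀))] * R σ)) := by
    rw [wedge_wedgeProd_apply]
    congr 1
    refine Finset.sum_congr rfl fun σ _ => ?_
    congr 2
    rw [← Finset.mul_prod_erase _ _ (Finset.mem_univ i₀), Function.update_self]
    congr 1
    refine Finset.prod_congr rfl fun i hi => ?_
    rw [Function.update_of_ne (Finset.ne_of_mem_erase hi)]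
  -- Transposing the head with the second position of slot `i₀` puts the arguments of `a` and `c i₀`
  -- where the first product has them. The sign turns the difference of the products into the sum in
  -- the Leibniz rule.
  have hsecond' : ∑ σ : Equiv.Perm (Fin (1 + 2 * n)), (Equiv.Perm.sign σ : ℤ) *
        ((c i₀ y fun _ => v (σ (headIdx n))) *
          (fderiv ℝ (fun z => a z fun _ => v (σ (sndIdx i₀))) y (v (σ (fstIdx i₀))) * R σ)) =
      -∑ σ : Equiv.Perm (Fin (1 + 2 * n)), (Equiv.Perm.sign σ : ℤ) *
        ((c i₀ y fun _ => v (σ (sndIdx i₀))) *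
          (fderiv ℝ (fun z => a z fun _ => v (σ (headIdx n))) y (v (σ (fstIdx i₀))) * R σ)) := by
    rw [← sum_sign_mul_swap (headIdx_ne_sndIdx i₀)]
    have h0 : Equiv.swap (headIdx n) (sndIdx i₀) (fstIdx i₀) = fstIdx i₀ :=
      Equiv.swap_apply_of_ne_of_ne (by simp) (by simp)
    simp only [hRswap _ _ _ (Or.inl rfl) rfl, Equiv.Perm.mul_apply, h0, Equiv.swap_apply_left,
      Equiv.swap_apply_right]
  have hleib : ∀ σ : Equiv.Perm (Fin (1 + 2 * n)),
      fderiv ℝ (fun z => ((a z fun _ => v (σ (headIdx n))) * (c i₀ z fun _ => v (σ (sndIdx i₀)))) *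
        ∏ i ∈ Finset.univ.erase i₀, extDeriv (c i) z ![v (σ (fstIdx i)), v (σ (sndIdx i))]) y
          (v (σ (fstIdx i₀))) =
      (a y fun _ => v (σ (headIdx n))) *
          (fderiv ℝ (fun z => c i₀ z fun _ => v (σ (sndIdx i₀))) y (v (σ (fstIdx i₀))) * R σ) +
      (c i₀ y fun _ => v (σ (sndIdx i₀))) *
          (fderiv ℝ (fun z => a z fun _ => v (σ (headIdx n))) y (v (σ (fstIdx i₀))) * R σ) +
      ∑ j ∈ Finset.univ.erase i₀,
        ((a y fun _ => v (σ (headIdx n))) * (c i₀ y fun _ => v (σ (sndIdx i₀))) *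
          (∏ i ∈ (Finset.univ.erase i₀).erase j,
            extDeriv (c i) y ![v (σ (fstIdx i)), v (σ (sndIdx i))]) *
          fderiv ℝ (fun z => extDeriv (c j) z ![v (σ (fstIdx j)), v (σ (sndIdx j))]) y
            (v (σ (fstIdx i₀)))) := by
    intro σ
    have hprod := HasFDerivAt.finsetProd (u := Finset.univ.erase i₀)
      (g := fun i z => extDeriv (c i) z ![v (σ (fstIdx i)), v (σ (sndIdx i))]) (x := y)
      (fun i _ => (hde i ![v (σ (fstIdx i)), v (σ (sndIdx i))]).hasFDerivAt)
    have hh := (((hdap ha (v (σ (headIdx n)))).hasFDerivAt.fun_mul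
      (hdap (hc i₀) (v (σ (sndIdx i₀)))).hasFDerivAt).fun_mul hprod)
    rw [hh.fderiv]
    simp only [add_apply, smul_apply, sum_apply, smul_eq_mul, Finset.mul_sum, hR]
    rw [add_comm, Finset.sum_congr rfl fun j _ => (mul_assoc _ _ _).symm]
    ring
  -- This is `d(dc_j) = 0`: each second derivative is symmetric in the direction of differentiation
  -- and one argument of `dc_j`, so transposing these two positions cancels the signed sum.
  have hthird : ∀ j ∈ Finset.univ.erase i₀, ∑ σ : Equiv.Perm (Fin (1 + 2 * n)),
      (Equiv.Perm.sign σ : ℤ) *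
        ((a y fun _ => v (σ (headIdx n))) * (c i₀ y fun _ => v (σ (sndIdx i₀))) *
          (∏ i ∈ (Finset.univ.erase i₀).erase j,
            extDeriv (c i) y ![v (σ (fstIdx i)), v (σ (sndIdx i))]) *
          fderiv ℝ (fun z => extDeriv (c j) z ![v (σ (fstIdx j)), v (σ (sndIdx j))]) y
            (v (σ (fstIdx i₀)))) = 0 := by
    intro j hj
    have hj' : j ≠ i₀ := Finset.ne_of_mem_erase hj
    have hsymm : ∀ w u u' : E, fderiv ℝ (fderiv ℝ fun z => c j z fun _ => w) y u u' =
        fderiv ℝ (fderiv ℝ fun z => c j z fun _ => w) y u' u := fun w u u' =>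
      ((hap (hc j) w).isSymmSndFDerivAt (by simpa using ENat.LEInfty.out)).eq u u'
    have hswap : ∀ k, (k = fstIdx j ∨ k = sndIdx j) → ∀ σ : Equiv.Perm (Fin (1 + 2 * n)),
        (σ * Equiv.swap (fstIdx i₀) k) (headIdx n) = σ (headIdx n) ∧
        (σ * Equiv.swap (fstIdx i₀) k) (sndIdx i₀) = σ (sndIdx i₀) ∧
        (∏ i ∈ (Finset.univ.erase i₀).erase j, extDeriv (c i) y
          ![v ((σ * Equiv.swap (fstIdx i₀) k) (fstIdx i)),
            v ((σ * Equiv.swap (fstIdx i₀) k) (sndIdx i))]) =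
        ∏ i ∈ (Finset.univ.erase i₀).erase j,
            extDeriv (c i) y ![v (σ (fstIdx i)), v (σ (sndIdx i))] := by
      intro k hk σ
      refine ⟨?_, ?_, Finset.prod_congr rfl fun i hi => ?_⟩
      · rw [Equiv.Perm.mul_apply, Equiv.swap_apply_of_ne_of_ne] <;> rcases hk with rfl | rfl <;> simp
      · rw [Equiv.Perm.mul_apply, Equiv.swap_apply_of_ne_of_ne] <;> rcases hk with rfl | rfl <;>
          simp [hj'.symm]
      · have h1 : i ≠ j := Finset.ne_of_mem_erase hi
        have h2 : i ≠ i₀ := Finset.ne_of_mem_erase (Finset.mem_of_mem_erase hi)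
        rw [Equiv.Perm.mul_apply, Equiv.Perm.mul_apply, Equiv.swap_apply_of_ne_of_ne,
          Equiv.swap_apply_of_ne_of_ne] <;> rcases hk with rfl | rfl <;> simp [h1, h2]
    simp only [fderiv_extDeriv_one_apply (hc j), mul_sub, Finset.sum_sub_distrib]
    rw [sum_sign_mul_eq_zero (i := fstIdx i₀) (j := fstIdx j) (by simpa using hj'.symm),
      sum_sign_mul_eq_zero (i := fstIdx i₀) (j := sndIdx j) (by simp), sub_zero]
    · intro σ
      obtain ⟨h1, h2, h3⟩ := hswap _ (Or.inr rfl) σ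
      have h4 : Equiv.swap (fstIdx i₀) (sndIdx j) (fstIdx j) = fstIdx j :=
        Equiv.swap_apply_of_ne_of_ne (by simpa using hj') (by simp)
      rw [h1, h2, h3]
      simp only [Equiv.Perm.mul_apply, h4, Equiv.swap_apply_left, Equiv.swap_apply_right]
      rw [hsymm]
    · intro σ
      obtain ⟨h1, h2, h3⟩ := hswap _ (Or.inl rfl) σ
      have h4 : Equiv.swap (fstIdx i₀) (fstIdx j) (sndIdx j) = sndIdx j :=
        Equiv.swap_apply_of_ne_of_ne (by simp) (by simp)
      rw [h1, h2, h3]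
      simp only [Equiv.Perm.mul_apply, h4, Equiv.swap_apply_left, Equiv.swap_apply_right]
      rw [hsymm]
  rw [hfirst, hsecond, hpart (hc i₀), hpart ha, hsecond']
  simp only [hleib, mul_add, Finset.sum_add_distrib, Finset.mul_sum (Finset.univ.erase i₀)]
  rw [Finset.sum_comm (s := Finset.univ) (t := Finset.univ.erase i₀), Finset.sum_congr rfl hthird,
    Finset.sum_const_zero]
  ring

end Divergence

/-! ### Linearity of products in one factor. -/

section Wedge

variable {V : Type*} [AddCommGroup V] [Module ℝ V] [TopologicalSpace V] {n : ℕ}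

theorem wedge_wedgeProd_sum_left {ι : Type*} (s : Finset ι) (a : ι → V [⋀^Fin 1]→L[ℝ] ℝ)
    (A : Fin n → V [⋀^Fin 2]→L[ℝ] ℝ) :
    wedge (∑ j ∈ s, a j) (wedgeProd A) = ∑ j ∈ s, wedge (a j) (wedgeProd A) := by
  ext v
  simp only [ContinuousAlternatingMap.sum_apply, wedge_wedgeProd_apply]
  rw [← Finset.mul_sum, Finset.sum_comm]
  simp only [Finset.sum_mul, Finset.mul_sum]

theorem wedge_wedgeProd_update_sum {ι : Type*} (s : Finset ι) (a : V [⋀^Fin 1]→L[ℝ] ℝ)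
    (A : Fin n → V [⋀^Fin 2]→L[ℝ] ℝ) (i₀ : Fin n) (B : ι → V [⋀^Fin 2]→L[ℝ] ℝ) :
    wedge a (wedgeProd (Function.update A i₀ (∑ j ∈ s, B j))) =
      ∑ j ∈ s, wedge a (wedgeProd (Function.update A i₀ (B j))) := by
  have key : ∀ (C : V [⋀^Fin 2]→L[ℝ] ℝ) (w : Fin n → Fin 2 → V),
      ∏ i, Function.update A i₀ C i (w i) =
        C (w i₀) * ∏ i ∈ Finset.univ.erase i₀, A i (w i) := by
    intro C w
    rw [← Finset.mul_prod_erase _ _ (Finset.mem_univ i₀), Function.update_self]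
    congr 1
    exact Finset.prod_congr rfl fun i hi => by
      rw [Function.update_of_ne (Finset.ne_of_mem_erase hi)]
  ext v
  simp only [ContinuousAlternatingMap.sum_apply, wedge_wedgeProd_apply, key]
  rw [← Finset.mul_sum, Finset.sum_comm]
  simp only [Finset.sum_mul, Finset.mul_sum]

theorem wedge_zero_wedgeProd (A : Fin n → V [⋀^Fin 2]→L[ℝ] ℝ) :
    wedge (0 : V [⋀^Fin 1]→L[ℝ] ℝ) (wedgeProd A) = 0 := by
  simpa using wedge_wedgeProd_sum_left (∅ : Finset Unit) (fun _ => 0) A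

theorem wedge_wedgeProd_update_zero (a : V [⋀^Fin 1]→L[ℝ] ℝ) (A : Fin n → V [⋀^Fin 2]→L[ℝ] ℝ)
    (i₀ : Fin n) : wedge a (wedgeProd (Function.update A i₀ 0)) = 0 := by
  simpa using wedge_wedgeProd_update_sum (∅ : Finset Unit) a A i₀ (fun _ => 0)

end Wedge

/-! ### Stokes' theorem on an open subset of a normed space. -/

section LocalStokes

open MeasureTheory Topology

variable {E : Type*} [NormedAddCommGroup E] [NormedSpace ℝ E] [FiniteDimensional ℝ E]
  [MeasurableSpace E] [BorelSpace E] (m : Measure E) [m.IsAddHaarMeasure]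

theorem integrableOn_of_eq_zero_off_compact {U K : Set E} (hU : IsOpen U) (hK : IsCompact K)
    (hKU : K ⊆ U) {f : E → ℝ} (hf : ContinuousOn f U) (h0 : ∀ y ∈ U, y ∉ K → f y = 0) :
    IntegrableOn f U m :=
  IntegrableOn.of_forall_sdiff_eq_zero ((hf.mono hKU).integrableOn_compact hK)
    hU.measurableSet fun y hy => h0 y hy.1 hy.2

/-- Integration by parts against the constant function `1`. -/
theorem integral_fderiv_apply_eq_zero {g : E → ℝ} (hg : ContDiff ℝ 1 g) (hs : HasCompactSupport g)
    (w : E) : ∫ y, fderiv ℝ g y w ∂m = 0 := by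
  have hi : Integrable (fun y => fderiv ℝ g y w) m :=
    ((hg.continuous_fderiv (by simp)).clm_apply continuous_const).integrable_of_hasCompactSupport
      (hs.fderiv_apply ℝ w)
  have h := integral_mul_fderiv_eq_neg_fderiv_mul_of_integrable (μ := m) (𝕜 := ℝ)
    (f := fun _ : E => (1 : ℝ)) (g := g) (v := w) (by simp) (by simpa using hi)
    (by simpa using hg.continuous.integrable_of_hasCompactSupport hs)
    (fun _ _ => differentiableAt_const _) (fun y _ => hg.differentiable (by simp) y)
  simpa using h

/-- Here `s` stands for the orientation sign of a chart, which is only locally constant. Since `h`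
vanishes off `K`, extending `s * h` by zero gives a `C¹` function with compact support on all of
`E`. -/
theorem setIntegral_mul_fderiv_eq_zero {U K : Set E} (hU : IsOpen U) (hK : IsCompact K)
    (hKU : K ⊆ U) {s h : E → ℝ} (hs : ∀ y ∈ U, s =ᶠ[𝓝 y] fun _ => s y)
    (hh : ∀ y ∈ U, ContDiffAt ℝ 1 h y) (h0 : ∀ y ∈ U, y ∉ K → h y = 0) (w : E) :
    IntegrableOn (fun y => s y * fderiv ℝ h y w) U m ∧
      ∫ y in U, s y * fderiv ℝ h y w ∂m = 0 := by
  classical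
  set g : E → ℝ := U.indicator fun y => s y * h y with hg
  have hgU : ∀ y ∈ U, g =ᶠ[𝓝 y] fun z => s y * h z := fun y hy => by
    filter_upwards [hU.mem_nhds hy, hs y hy] with z hz hz'
    rw [hg, Set.indicator_of_mem hz, hz']
  have hgK : ∀ y, y ∉ K → g =ᶠ[𝓝 y] fun _ => 0 := fun y hy => by
    filter_upwards [hK.isClosed.isOpen_compl.mem_nhds hy] with z hz
    by_cases hzU : z ∈ U
    · rw [hg, Set.indicator_of_mem hzU, h0 z hzU hz, mul_zero]
    · rw [hg, Set.indicator_of_notMem hzU]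
  have hgc : ContDiff ℝ 1 g := contDiff_iff_contDiffAt.2 fun y => by
    by_cases hy : y ∈ U
    · exact (contDiffAt_const.mul (hh y hy)).congr_of_eventuallyEq (hgU y hy)
    · exact contDiffAt_const.congr_of_eventuallyEq (hgK y fun h => hy (hKU h))
  have hgs : HasCompactSupport g := HasCompactSupport.intro hK fun y hy => (hgK y hy).eq_of_nhds
  have hd : (fun y => fderiv ℝ g y w) = U.indicator fun y => s y * fderiv ℝ h y w := by
    funext y
    by_cases hy : y ∈ U
    · rw [Set.indicator_of_mem hy, (hgU y hy).fderiv_eq,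
        fderiv_const_mul ((hh y hy).differentiableAt (by simp))]
      rfl
    · rw [Set.indicator_of_notMem hy, (hgK y fun h => hy (hKU h)).fderiv_eq]
      simp
  constructor
  · rw [← integrable_indicator_iff hU.measurableSet, ← hd]
    exact ((hgc.continuous_fderiv (by simp)).clm_apply
      continuous_const).integrable_of_hasCompactSupport (hgs.fderiv_apply ℝ w)
  · rw [← integral_indicator hU.measurableSet, ← hd]
    exact integral_fderiv_apply_eq_zero m hgc hgs w

/-- Stokes' theorem for `d(a ∧ c_{i₀} ∧ dc₀ ∧ ⋯)` with compactly supported `a`. -/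
theorem setIntegral_wedge_extDeriv_sub_swap_eq_zero {n : ℕ} {U K : Set E} (hU : IsOpen U)
    (hK : IsCompact K) (hKU : K ⊆ U) {s : E → ℝ} (hs : ∀ y ∈ U, s =ᶠ[𝓝 y] fun _ => s y)
    {a : E → E [⋀^Fin 1]→L[ℝ] ℝ} {c : Fin n → E → E [⋀^Fin 1]→L[ℝ] ℝ}
    (ha : ∀ y ∈ U, ContDiffAt ℝ ∞ a y) (hc : ∀ i, ∀ y ∈ U, ContDiffAt ℝ ∞ (c i) y)
    (h0 : ∀ y ∈ U, y ∉ K → a y = 0) (i₀ : Fin n) (v : Fin (1 + 2 * n) → E) :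
    ∫ y in U, s y * (wedge (a y) (wedgeProd fun i => extDeriv (c i) y) v -
      wedge (c i₀ y) (wedgeProd fun i => extDeriv (Function.update c i₀ a i) y) v) ∂m = 0 := by
  have happ : ∀ {k : ℕ} {f : E → E [⋀^Fin k]→L[ℝ] ℝ} {y : E} (_ : ContDiffAt ℝ ∞ f y)
      (w : Fin k → E), ContDiffAt ℝ 1 (fun z => f z w) y := fun hf w =>
    ((ContinuousAlternatingMap.apply ℝ E ℝ w).contDiff.contDiffAt.comp _ hf).of_le (by simp)
  have key := fun σ : Equiv.Perm (Fin (1 + 2 * n)) =>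
    setIntegral_mul_fderiv_eq_zero m hU hK hKU hs
    (h := fun z => ((a z fun _ => v (σ (headIdx n))) * (c i₀ z fun _ => v (σ (sndIdx i₀)))) *
        ∏ i ∈ Finset.univ.erase i₀, extDeriv (c i) z ![v (σ (fstIdx i)), v (σ (sndIdx i))])
    (fun y hy => ((happ (ha y hy) _).mul (happ (hc i₀ y hy) _)).mul
      (contDiffAt_prod fun i _ => happ (contDiffAt_extDeriv (hc i y hy)) _))
    (fun y hy hyK => by simp [h0 y hy hyK]) (v (σ (fstIdx i₀)))
  rw [setIntegral_congr_fun hU.measurableSet (g := fun y =>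
    ∑ σ : Equiv.Perm (Fin (1 + 2 * n)), (2 * (1 / 2) ^ n * (Equiv.Perm.sign σ : ℤ)) * (s y *
      fderiv ℝ (fun z => ((a z fun _ => v (σ (headIdx n))) * (c i₀ z fun _ => v (σ (sndIdx i₀)))) *
        ∏ i ∈ Finset.univ.erase i₀, extDeriv (c i) z ![v (σ (fstIdx i)), v (σ (sndIdx i))]) y
          (v (σ (fstIdx i₀))))),
    integral_finsetSum _ fun σ _ => (key σ).1.const_mul _]
  · refine Finset.sum_eq_zero fun σ _ => ?_
    rw [integral_const_mul, (key σ).2, mul_zero]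
  · intro y hy
    beta_reduce
    rw [wedge_extDeriv_sub_swap (ha y hy) (fun i => hc i y hy), Finset.mul_sum, Finset.mul_sum]
    exact Finset.sum_congr rfl fun σ _ => by ring

end LocalStokes

/-! ### The integral: additivity and computation in a single chart. -/

section IntegralLemmas

open MeasureTheory Topology

set_option linter.unusedSectionVars false

section

variable {E : Type*} [NormedAddCommGroup E] [NormedSpace ℝ E]
  {H : Type*} [TopologicalSpace H] {I : ModelWithCorners ℝ E H}
  {M : Type*} [TopologicalSpace M] [ChartedSpace H M]

theorem DForm.inChart_sum {k : ℕ} {ι : Type*} (s : Finset ι) (η : ι → DForm I M k) (x₀ : M)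
    (y : E) (v : Fin k → E) :
    DForm.inChart (fun x => ∑ j ∈ s, η j x) x₀ y v = ∑ j ∈ s, (η j).inChart x₀ y v := by
  simp only [DForm.inChart]
  exact ContinuousAlternatingMap.sum_apply _ _

end

variable {E : Type*} [NormedAddCommGroup E] [NormedSpace ℝ E] [FiniteDimensional ℝ E]
  [MeasurableSpace E] [BorelSpace E]
  {H : Type*} [TopologicalSpace H] {I : ModelWithCorners ℝ E H} [I.Boundaryless]
  {M : Type*} [TopologicalSpace M] [ChartedSpace H M] [IsManifold I ∞ M]
  [T2Space M] [CompactSpace M]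

theorem apply_comp_basis {W : Type*} [AddCommGroup W] [Module ℝ W] {ι : Type*} [Fintype ι]
    [DecidableEq ι] (b : Module.Basis ι ℝ W) (f : W [⋀^ι]→ₗ[ℝ] ℝ) (L : W →ₗ[ℝ] W) :
    f (fun i => L (b i)) = LinearMap.det L * f b := by
  conv_lhs => rw [f.eq_smul_basis_det b]
  have := b.det_comp_basis b L
  simp only [AlternatingMap.smul_apply, smul_eq_mul]
  change _ * b.det (L ∘ b) = _
  rw [this, Module.Basis.equiv_refl]
  exact mul_comm _ _

theorem alternatingForm_apply_basis_ne_zero {W : Type*} [AddCommGroup W] [Module ℝ W] {ι : Type*}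
    [Fintype ι] [DecidableEq ι] (b : Module.Basis ι ℝ W) {f : W [⋀^ι]→ₗ[ℝ] ℝ} (hf : f ≠ 0) :
    f b ≠ 0 := fun h => hf <| by rw [f.eq_smul_basis_det b, h, zero_smul]

/-- Continuity of a form, tested on constant vectors in charts. -/
def DForm.IsContinuous {k : ℕ} (η : DForm I M k) : Prop :=
  ∀ (x₀ : M) (v : Fin k → E),
    ContinuousOn (fun y => η.inChart x₀ y v) (extChartAt I x₀).target

theorem DForm.inChart_of_eq_zero {k : ℕ} {η : DForm I M k} {x₀ : M} {y : E}
    (h : η ((extChartAt I x₀).symm y) = 0) : η.inChart x₀ y = 0 := by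
  rw [DForm.inChart, h]; rfl

/-- The coefficient of a form of top degree in a chart, with the sign determined by `μ`. -/
def chartCoeff {k : ℕ} (hk : Module.finrank ℝ E = k) (μ η : DForm I M k) (x₀ : M) (y : E) : ℝ :=
  (SignType.sign (μ.inChart x₀ y (Module.finBasisOfFinrankEq ℝ E hk)) : ℝ) *
    η.inChart x₀ y (Module.finBasisOfFinrankEq ℝ E hk)

/-- The Lebesgue measure used for integration in charts. -/
abbrev chartMeasure {k : ℕ} (hk : Module.finrank ℝ E = k) : Measure E :=
  (Module.finBasisOfFinrankEq ℝ E hk).addHaar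

variable (I M) in
/-- The finitely many indices of functions in the partition of unity. -/
theorem exists_chartPartition_support :
    ∃ S : Finset M, ∀ i ∉ S, ∀ x, chartPartition I M i x = 0 := by
  have h := (chartPartition I M).locallyFinite.finite_nonempty_of_compact
  refine ⟨h.toFinset, fun i hi x => ?_⟩
  by_contra hx
  exact hi (h.mem_toFinset.2 ⟨x, hx⟩)

variable (I M) in
/-- A finite set of indices outside of which the functions in the partition of unity vanish. -/
def chartIndices : Finset M := (exists_chartPartition_support I M).choose

theorem chartPartition_eq_zero {i : M} (hi : i ∉ chartIndices I M) (x : M) :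
    chartPartition I M i x = 0 := (exists_chartPartition_support I M).choose_spec i hi x

theorem sum_chartPartition (x : M) : ∑ i ∈ chartIndices I M, chartPartition I M i x = 1 := by
  rw [← (chartPartition I M).sum_eq_one (Set.mem_univ x)]
  refine (finsum_eq_sum_of_support_subset _ fun i hi => ?_).symm
  by_contra h
  exact hi (chartPartition_eq_zero h x)

theorem tsupport_chartPartition_subset (i : M) :
    tsupport (chartPartition I M i) ⊆ (extChartAt I i).source := by
  rw [extChartAt_source]
  exact (SmoothPartitionOfUnity.exists_isSubordinate_chartAt_source I M).choose_spec i

theorem integral_eq_sum {k : ℕ} (hk : Module.finrank ℝ E = k) (μ η : DForm I M k) :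
    integral hk μ η = ∑ i ∈ chartIndices I M, ∫ y in (extChartAt I i).target,
      chartPartition I M i ((extChartAt I i).symm y) * chartCoeff hk μ η i y
        ∂chartMeasure hk := by
  refine finsum_eq_sum_of_support_subset _ fun i hi => ?_
  by_contra h
  refine hi ?_
  simp [chartPartition_eq_zero (I := I) (M := M) h]

theorem isCompact_image_tsupport (i : M) :
    IsCompact (extChartAt I i '' tsupport (chartPartition I M i)) :=
  ((isClosed_tsupport _).isCompact).image_of_continuousOn
    ((continuousOn_extChartAt i).mono (tsupport_chartPartition_subset i))

theorem image_tsupport_subset (i : M) :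
    extChartAt I i '' tsupport (chartPartition I M i) ⊆ (extChartAt I i).target := by
  rintro _ ⟨x, hx, rfl⟩
  exact (extChartAt I i).map_source (tsupport_chartPartition_subset i hx)

theorem symm_notMem_tsupport {i : M} {y : E} (hy : y ∈ (extChartAt I i).target)
    (h : y ∉ extChartAt I i '' tsupport (chartPartition I M i)) :
    (extChartAt I i).symm y ∉ tsupport (chartPartition I M i) := fun h' =>
  h ⟨_, h', (extChartAt I i).right_inv hy⟩

theorem DForm.inChart_basis_ne_zero {k : ℕ} (hk : Module.finrank ℝ E = k) {μ : DForm I M k}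
    (hμ : ∀ x, μ x ≠ 0) {i : M} {y : E} (hy : y ∈ (extChartAt I i).target) :
    μ.inChart i y (Module.finBasisOfFinrankEq ℝ E hk) ≠ 0 := by
  have hne : μ.inChart i y ≠ 0 := by
    intro h0
    apply hμ ((extChartAt I i).symm y)
    ext v
    have h := congrArg (fun f => f (fun j => mfderiv I 𝓘(ℝ, E) (extChartAt I i)
      ((extChartAt I i).symm y) (v j))) h0
    refine Eq.trans ?_ h
    change _ = μ ((extChartAt I i).symm y) (fun j => mfderiv 𝓘(ℝ, E) I (extChartAt I i).symm y
      (mfderiv I 𝓘(ℝ, E) (extChartAt I i) ((extChartAt I i).symm y) (v j)))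
    congr 1
    funext j
    exact (mfderiv_extChartAt_symm_apply hy (v j)).symm
  exact alternatingForm_apply_basis_ne_zero _
    (f := (μ.inChart i y).toAlternatingMap) fun h => hne (by
      ext v; exact congrArg (fun f => f v) h)

theorem DForm.IsSmooth.isContinuous {k : ℕ} {η : DForm I M k} (hη : η.IsSmooth) :
    η.IsContinuous := fun x₀ v =>
  (ContinuousAlternatingMap.apply ℝ E ℝ v).continuous.comp_continuousOn (hη x₀).continuousOn

/-- The coefficient of `μ` is continuous without zeros. Its sign is constant only locally, as the
target of a chart may be disconnected. -/
theorem sign_eventuallyEq {k : ℕ} (hk : Module.finrank ℝ E = k) {μ : DForm I M k}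
    (hμ : μ.IsOrientation) (i : M) : ∀ y ∈ (extChartAt I i).target,
    (fun y => (SignType.sign (μ.inChart i y (Module.finBasisOfFinrankEq ℝ E hk)) : ℝ)) =ᶠ[𝓝 y]
      fun _ => SignType.sign (μ.inChart i y (Module.finBasisOfFinrankEq ℝ E hk)) := by
  intro y hy
  have hc := (hμ.1.isContinuous i (Module.finBasisOfFinrankEq ℝ E hk)).continuousAt
    ((isOpen_extChartAt_target i).mem_nhds hy)
  rcases lt_or_gt_of_ne (DForm.inChart_basis_ne_zero hk hμ.2 hy) with h | h
  · filter_upwards [hc.eventually (eventually_lt_nhds h)] with z hz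
    rw [sign_neg hz, sign_neg h]
  · filter_upwards [hc.eventually (eventually_gt_nhds h)] with z hz
    rw [sign_pos hz, sign_pos h]

theorem continuousOn_chartCoeff {k : ℕ} (hk : Module.finrank ℝ E = k) {μ η : DForm I M k}
    (hμ : μ.IsOrientation) (hη : η.IsContinuous) (i : M) :
    ContinuousOn (chartCoeff hk μ η i) (extChartAt I i).target := fun y hy =>
  ((continuousAt_const.congr (sign_eventuallyEq hk hμ i y hy).symm).continuousWithinAt).mul
    (hη i _ y hy)

theorem continuousOn_chartPartition_symm (i j : M) :
    ContinuousOn (fun y => chartPartition I M i ((extChartAt I j).symm y))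
      (extChartAt I j).target :=
  (chartPartition I M i).contMDiff.continuous.comp_continuousOn (continuousOn_extChartAt_symm j)

theorem integral_sum {k : ℕ} (hk : Module.finrank ℝ E = k) {μ : DForm I M k}
    (hμ : μ.IsOrientation) {ι : Type*} (s : Finset ι) {η : ι → DForm I M k}
    (hη : ∀ j ∈ s, (η j).IsContinuous) :
    integral hk μ (fun x => ∑ j ∈ s, η j x) = ∑ j ∈ s, integral hk μ (η j) := by
  simp only [integral_eq_sum]
  rw [Finset.sum_comm]
  refine Finset.sum_congr rfl fun i _ => ?_
  rw [← MeasureTheory.integral_finsetSum]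
  · refine integral_congr_ae (Filter.Eventually.of_forall fun y => ?_)
    simp only [chartCoeff, DForm.inChart_sum, Finset.mul_sum]
  · intro j hj
    refine integrableOn_of_eq_zero_off_compact _ (isOpen_extChartAt_target i)
      (isCompact_image_tsupport i) (image_tsupport_subset i)
      ((continuousOn_chartPartition_symm i i).mul (continuousOn_chartCoeff hk hμ (hη j hj) i))
      fun y hy hyK => ?_
    rw [image_eq_zero_of_notMem_tsupport (symm_notMem_tsupport hy hyK), zero_mul]

/-- Change of variables on the overlap of the charts; off the overlap `η` vanishes in chart `i` and
the partition function vanishes in chart `j`. The coefficients of `μ` and `η` both scale by the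
determinant of the transition map, and `sign d * d = |d|` is the Jacobian factor. -/
theorem setIntegral_chartCoeff_eq {k : ℕ} (hk : Module.finrank ℝ E = k) (μ : DForm I M k)
    {η : DForm I M k} (i j : M) (h0 : ∀ x, x ∉ (extChartAt I j).source → η x = 0) :
    ∫ y in (extChartAt I i).target, chartPartition I M i ((extChartAt I i).symm y) *
        chartCoeff hk μ η i y ∂chartMeasure hk =
      ∫ y in (extChartAt I j).target, chartPartition I M i ((extChartAt I j).symm y) *
        chartCoeff hk μ η j y ∂chartMeasure hk := by
  set A := (extChartAt I i).target ∩ (extChartAt I i).symm ⁻¹' (extChartAt I j).source with hA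
  set B := (extChartAt I j).target ∩ (extChartAt I j).symm ⁻¹' (extChartAt I i).source with hB
  have hAo : IsOpen A := (continuousOn_extChartAt_symm i).isOpen_inter_preimage
    (isOpen_extChartAt_target i) (isOpen_extChartAt_source j)
  have hBo : IsOpen B := (continuousOn_extChartAt_symm j).isOpen_inter_preimage
    (isOpen_extChartAt_target j) (isOpen_extChartAt_source i)
  rw [setIntegral_eq_of_subset_of_forall_sdiff_eq_zero
    (isOpen_extChartAt_target i).measurableSet (s := A) Set.inter_subset_left,
    setIntegral_eq_of_subset_of_forall_sdiff_eq_zero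
    (isOpen_extChartAt_target j).measurableSet (s := B) Set.inter_subset_left]
  rotate_left
  · rintro y ⟨hy, hyB⟩
    have : (extChartAt I j).symm y ∉ (extChartAt I i).source := fun h => hyB ⟨hy, h⟩
    rw [image_eq_zero_of_notMem_tsupport fun h => this (tsupport_chartPartition_subset i h),
      zero_mul]
  · rintro y ⟨hy, hyA⟩
    have : (extChartAt I i).symm y ∉ (extChartAt I j).source := fun h => hyA ⟨hy, h⟩
    rw [chartCoeff, DForm.inChart_of_eq_zero (η := η) (h0 _ this)]
    simp
  have himage : (extChartAt I j ∘ (extChartAt I i).symm) '' A = B := by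
    ext y
    constructor
    · rintro ⟨z, ⟨hz, hz'⟩, rfl⟩
      refine ⟨(extChartAt I j).map_source hz', ?_⟩
      simp only [Set.mem_preimage, Function.comp_apply]
      rw [(extChartAt I j).left_inv hz']
      exact (extChartAt I i).map_target hz
    · rintro ⟨hy, hy'⟩
      refine ⟨extChartAt I i ((extChartAt I j).symm y), ⟨(extChartAt I i).map_source hy', ?_⟩, ?_⟩
      · simp only [Set.mem_preimage]
        rw [(extChartAt I i).left_inv hy']
        exact (extChartAt I j).map_target hy
      · simp only [Function.comp_apply]
        rw [(extChartAt I i).left_inv hy', (extChartAt I j).right_inv hy]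
  have hinj : Set.InjOn (extChartAt I j ∘ (extChartAt I i).symm) A := by
    rintro y ⟨hy, hy'⟩ z ⟨hz, hz'⟩ h
    exact (extChartAt I i).symm.injOn hy hz ((extChartAt I j).injOn hy' hz' h)
  have hdiff : ∀ y ∈ A, HasFDerivWithinAt (extChartAt I j ∘ (extChartAt I i).symm)
      (fderiv ℝ (extChartAt I j ∘ (extChartAt I i).symm) y) A y := fun y hy =>
    ((contDiffAt_extChartAt_comp (contMDiffAt_extChartAt_symm hy.1) hy.2).differentiableAt
      (by simp)).hasFDerivAt.hasFDerivWithinAt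
  rw [← himage, integral_image_eq_integral_abs_det_fderiv_smul (chartMeasure hk)
    hAo.measurableSet hdiff hinj]
  refine setIntegral_congr_fun hAo.measurableSet fun y hy => ?_
  have hpull : ∀ ζ : DForm I M k, ζ.inChart i y (Module.finBasisOfFinrankEq ℝ E hk) =
      (fderiv ℝ (extChartAt I j ∘ (extChartAt I i).symm) y).det *
        ζ.inChart j (extChartAt I j ((extChartAt I i).symm y))
          (Module.finBasisOfFinrankEq ℝ E hk) := by
    intro ζ
    rw [DForm.inChart_eq_pull ζ i,
      ζ.pull_eq_inChart (mdifferentiableAt_extChartAt_symm hy.1) hy.2]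
    exact apply_comp_basis (Module.finBasisOfFinrankEq ℝ E hk)
      (ζ.inChart j (extChartAt I j ((extChartAt I i).symm y))).toAlternatingMap
      (fderiv ℝ (extChartAt I j ∘ (extChartAt I i).symm) y).toLinearMap
  simp only [chartCoeff, hpull, Function.comp_apply, smul_eq_mul, sign_mul, SignType.coe_mul]
  rw [(extChartAt I j).left_inv hy.2]
  have habs : ∀ d : ℝ, (SignType.sign d : ℝ) * d = |d| := fun d => sign_mul_self d
  rw [← habs]
  ring

/-- The integral of a form supported in a chart can be computed in this chart. -/
theorem integral_eq_setIntegral {k : ℕ} (hk : Module.finrank ℝ E = k) {μ η : DForm I M k}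
    (hμ : μ.IsOrientation) (hη : η.IsContinuous) (j : M)
    (h0 : ∀ x, x ∉ tsupport (chartPartition I M j) → η x = 0) :
    integral hk μ η =
      ∫ y in (extChartAt I j).target, chartCoeff hk μ η j y ∂chartMeasure hk := by
  -- All summands are moved to the chart at `j`, where the partition functions add up to `1`.
  rw [integral_eq_sum, Finset.sum_congr rfl fun i _ => setIntegral_chartCoeff_eq hk μ i j
    fun x hx => h0 x fun h => hx (tsupport_chartPartition_subset j h),
    ← MeasureTheory.integral_finsetSum]
  · simp only [← Finset.sum_mul, sum_chartPartition, one_mul]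
  · intro i _
    refine integrableOn_of_eq_zero_off_compact _ (isOpen_extChartAt_target j)
      (isCompact_image_tsupport j) (image_tsupport_subset j)
      ((continuousOn_chartPartition_symm i j).mul (continuousOn_chartCoeff hk hμ hη j))
      fun y hy hyK => ?_
    rw [chartCoeff, DForm.inChart_of_eq_zero (h0 _ (symm_notMem_tsupport hy hyK))]
    simp

end IntegralLemmas

/-! ### Stokes' theorem on a closed manifold. -/

section Stokes

open MeasureTheory Topology

set_option linter.unusedSectionVars false

section

variable {E : Type*} [NormedAddCommGroup E] [NormedSpace ℝ E]
  {H : Type*} [TopologicalSpace H] {I : ModelWithCorners ℝ E H} [I.Boundaryless]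
  {M : Type*} [TopologicalSpace M] [ChartedSpace H M] [IsManifold I ∞ M] {n : ℕ}

/-- The form `a ∧ dc₀ ∧ ⋯ ∧ dc_{n-1}`. -/
def wedgeExact (a : DForm I M 1) (c : Fin n → DForm I M 1) : DForm I M (1 + 2 * n) := fun x =>
  wedge (a x) (wedgeProd fun i => (c i).d x)

theorem inChart_wedgeExact (a : DForm I M 1) {c : Fin n → DForm I M 1} (hc : ∀ i, (c i).IsSmooth)
    {x₀ : M} {y : E} (hy : y ∈ (extChartAt I x₀).target) :
    (wedgeExact a c).inChart x₀ y =
      wedge (a.inChart x₀ y) (wedgeProd fun i => extDeriv ((c i).inChart x₀) y) := by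
  have h : (fun i => extDeriv ((c i).inChart x₀) y) = fun i => (c i).d.inChart x₀ y :=
    funext fun i => ((hc i).inChart_d hy).symm
  rw [h]
  exact wedge_wedgeProd_comp (V := TangentSpace I ((extChartAt I x₀).symm y)) (W := E) _ _ _

theorem continuousAt_wedge_wedgeProd {a : E → E [⋀^Fin 1]→L[ℝ] ℝ}
    {A : Fin n → E → E [⋀^Fin 2]→L[ℝ] ℝ} {y : E} (ha : ContinuousAt a y)
    (hA : ∀ i, ContinuousAt (A i) y) (v : Fin (1 + 2 * n) → E) :
    ContinuousAt (fun z => wedge (a z) (wedgeProd fun i => A i z) v) y := by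
  simp only [wedge_wedgeProd_apply]
  have happ : ∀ {k : ℕ} {f : E → E [⋀^Fin k]→L[ℝ] ℝ} (_ : ContinuousAt f y)
      (w : Fin k → E), ContinuousAt (fun z => f z w) y := fun hf w =>
    (ContinuousAlternatingMap.apply ℝ E ℝ w).continuous.continuousAt.comp hf
  refine continuousAt_const.mul (tendsto_finsetSum _ fun σ _ => ?_)
  exact continuousAt_const.mul ((happ ha _).mul (tendsto_finsetProd _ fun i _ => happ (hA i) _))

theorem isContinuous_wedgeExact {a : DForm I M 1} {c : Fin n → DForm I M 1} (ha : a.IsSmooth)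
    (hc : ∀ i, (c i).IsSmooth) : (wedgeExact a c).IsContinuous := by
  intro _ v y hy
  refine ContinuousWithinAt.congr (f := fun y => wedge (a.inChart _ y)
    (wedgeProd fun i => extDeriv ((c i).inChart _) y) v) ?_
    (fun z hz => by rw [inChart_wedgeExact a hc hz]) (by rw [inChart_wedgeExact a hc hy])
  exact (continuousAt_wedge_wedgeProd (ha.contDiffAt_inChart hy).continuousAt
    (fun i => (contDiffAt_extDeriv ((hc i).contDiffAt_inChart hy)).continuousAt)
    v).continuousWithinAt

/-- The product of a function and a form. -/
def DForm.mulFun {k : ℕ} (f : M → ℝ) (η : DForm I M k) : DForm I M k := fun x => f x • η x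

theorem DForm.IsSmooth.mulFun {k : ℕ} {η : DForm I M k} (hη : η.IsSmooth) {f : M → ℝ}
    (hf : ContMDiff I 𝓘(ℝ) ∞ f) : (η.mulFun f).IsSmooth :=
  DForm.isSmooth_of_contDiffAt fun x₀ y hy =>
    (((hf _).comp y (contMDiffAt_extChartAt_symm (I := I) hy)).contDiffAt).smul
      (hη.contDiffAt_inChart hy)

theorem DForm.d_congr {k : ℕ} {η θ : DForm I M k} {x : M} (h : ∀ᶠ z in 𝓝 x, η z = θ z) :
    η.d x = θ.d x := by
  have hc : ContinuousAt (extChartAt I x).symm (extChartAt I x x) :=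
    continuousAt_extChartAt_symm x
  have h1 : η.inChart x =ᶠ[𝓝 (extChartAt I x x)] θ.inChart x := by
    have h2 : ∀ᶠ y in 𝓝 (extChartAt I x x), η ((extChartAt I x).symm y) =
        θ ((extChartAt I x).symm y) := by
      refine hc.eventually (p := fun z => η z = θ z) ?_
      rwa [extChartAt_to_inv]
    filter_upwards [h2] with y hy
    rw [DForm.inChart, DForm.inChart, hy]
  rw [DForm.d, DForm.d, h1.extDeriv_eq]

theorem DForm.d_zero {k : ℕ} (x : M) : DForm.d (fun _ => 0 : DForm I M k) x = 0 := by
  have h : DForm.inChart (fun _ => 0 : DForm I M k) x = fun _ => 0 := rfl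
  have h2 : extDeriv (fun _ : E => (0 : E [⋀^Fin k]→L[ℝ] ℝ)) (extChartAt I x x) = 0 := by
    have := extDeriv_smul (𝕜 := ℝ) (x := extChartAt I x x) 0
      (fun _ : E => (0 : E [⋀^Fin k]→L[ℝ] ℝ))
    rw [zero_smul, zero_smul] at this
    exact this
  rw [DForm.d, h, h2]
  rfl

theorem DForm.d_sum {k : ℕ} {ι : Type*} (s : Finset ι) {η : ι → DForm I M k}
    (hη : ∀ j, (η j).IsSmooth) (x : M) :
    DForm.d (fun x => ∑ j ∈ s, η j x) x = ∑ j ∈ s, (η j).d x := by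
  have hx := mem_extChartAt_target (I := I) x
  have h : DForm.inChart (fun x => ∑ j ∈ s, η j x) x = fun y => ∑ j ∈ s, (η j).inChart x y := by
    funext y; ext v
    rw [DForm.inChart_sum, ContinuousAlternatingMap.sum_apply]
  have h2 : extDeriv (fun y => ∑ j ∈ s, (η j).inChart x y) (extChartAt I x x) =
      ∑ j ∈ s, extDeriv ((η j).inChart x) (extChartAt I x x) := by
    simp only [extDeriv]
    rw [fderiv_fun_sum fun j _ => ((hη j).contDiffAt_inChart hx).differentiableAt (by simp)]
    simp only [← ContinuousAlternatingMap.alternatizeUncurryFinCLM_apply, map_sum]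
  rw [DForm.d, h, h2]
  ext v
  simp only [ContinuousAlternatingMap.sum_apply, DForm.d]
  exact ContinuousAlternatingMap.sum_apply _ _

theorem d_update_eq (a : DForm I M 1) (c : Fin n → DForm I M 1) (i₀ : Fin n) (x : M) :
    (fun i => (Function.update c i₀ a i).d x) =
      Function.update (fun i => (c i).d x) i₀ (a.d x) := by
  funext i
  by_cases h : i = i₀
  · subst h; simp
  · simp [h]

end

variable {E : Type*} [NormedAddCommGroup E] [NormedSpace ℝ E] [FiniteDimensional ℝ E]
  [MeasurableSpace E] [BorelSpace E]
  {H : Type*} [TopologicalSpace H] {I : ModelWithCorners ℝ E H} [I.Boundaryless]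
  {M : Type*} [TopologicalSpace M] [ChartedSpace H M] [IsManifold I ∞ M]
  [T2Space M] [CompactSpace M] {n : ℕ}

theorem integral_sub {k : ℕ} (hk : Module.finrank ℝ E = k) {μ : DForm I M k}
    (hμ : μ.IsOrientation) {η θ : DForm I M k} (hη : η.IsContinuous) (hθ : θ.IsContinuous) :
    integral hk μ (fun x => η x - θ x) = integral hk μ η - integral hk μ θ := by
  have hd : DForm.IsContinuous (fun x => η x - θ x) := fun x₀ v => (hη x₀ v).sub (hθ x₀ v)
  have h := integral_sum hk hμ (Finset.univ : Finset (Fin 2))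
    (η := ![fun x => η x - θ x, θ]) fun j _ => by
      fin_cases j
      · exact hd
      · exact hθ
  simp only [Fin.sum_univ_two, Matrix.cons_val_zero, Matrix.cons_val_one, sub_add_cancel] at h
  linarith

/-- Once `a` is cut off by a partition function, both forms are supported in one chart, where the
local version applies. -/
theorem integral_wedgeExact_mulFun {hk : Module.finrank ℝ E = 1 + 2 * n} {μ : DForm I M (1 + 2 * n)}
    (hμ : μ.IsOrientation) {a : DForm I M 1} {c : Fin n → DForm I M 1} (ha : a.IsSmooth)
    (hc : ∀ i, (c i).IsSmooth) (i₀ : Fin n) (j : M) :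
    integral hk μ (wedgeExact (a.mulFun (chartPartition I M j)) c) =
      integral hk μ (wedgeExact (c i₀)
        (Function.update c i₀ (a.mulFun (chartPartition I M j)))) := by
  set a' := a.mulFun (chartPartition I M j) with ha'
  have hsm : a'.IsSmooth := ha.mulFun (chartPartition I M j).contMDiff
  have hc' : ∀ i, (Function.update c i₀ a' i).IsSmooth := fun i => by
    by_cases h : i = i₀
    · subst h; simpa using hsm
    · simpa [h] using hc i
  have h1 := isContinuous_wedgeExact hsm hc
  have h2 := isContinuous_wedgeExact (hc i₀) hc'
  rw [← sub_eq_zero, ← integral_sub hk hμ h1 h2]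
  have h12 : DForm.IsContinuous fun x => wedgeExact a' c x -
      wedgeExact (c i₀) (Function.update c i₀ a') x := fun x₀ v => (h1 x₀ v).sub (h2 x₀ v)
  -- Vanishing in a neighbourhood is needed, because one of the products contains `d a'`.
  have hzero : ∀ x, x ∉ tsupport (chartPartition I M j) → ∀ᶠ z in 𝓝 x, a' z = 0 := by
    intro x hx
    filter_upwards [(isClosed_tsupport (chartPartition I M j)).isOpen_compl.mem_nhds hx] with z hz
    rw [ha', DForm.mulFun, image_eq_zero_of_notMem_tsupport hz, zero_smul]
  rw [integral_eq_setIntegral hk hμ h12 j]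
  · rw [setIntegral_congr_fun (isOpen_extChartAt_target j).measurableSet]
    · exact setIntegral_wedge_extDeriv_sub_swap_eq_zero (chartMeasure hk)
        (isOpen_extChartAt_target j) (isCompact_image_tsupport j) (image_tsupport_subset j)
        (sign_eventuallyEq hk hμ j) (a := a'.inChart j) (c := fun i => (c i).inChart j)
        (fun y hy => hsm.contDiffAt_inChart hy) (fun i y hy => (hc i).contDiffAt_inChart hy)
        (fun y hy hyK => DForm.inChart_of_eq_zero
          (hzero _ (symm_notMem_tsupport hy hyK)).self_of_nhds) i₀
        (Module.finBasisOfFinrankEq ℝ E hk)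
    · intro y hy
      simp only [chartCoeff]
      congr 1
      have h3 := inChart_wedgeExact a' hc hy
      have h4 := inChart_wedgeExact (c i₀) hc' hy
      have h5 : (fun i => extDeriv ((Function.update c i₀ a' i).inChart j) y) =
          fun i => extDeriv (Function.update (fun i => (c i).inChart j) i₀ (a'.inChart j) i) y := by
        funext i
        by_cases h : i = i₀
        · subst h; simp
        · simp [h]
      rw [h5] at h4
      rw [← h3, ← h4]
      rfl
  · intro x hx
    have h3 : a'.d x = 0 := by rw [DForm.d_congr (hzero x hx), DForm.d_zero]
    simp only [wedgeExact]
    rw [(hzero x hx).self_of_nhds, wedge_zero_wedgeProd, d_update_eq, h3,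
      wedge_wedgeProd_update_zero, sub_zero]

/-- Stokes' theorem for the form `a ∧ c_{i₀} ∧ dc₀ ∧ ⋯ ∧ dc_{n-1}` with `dc_{i₀}` omitted. -/
theorem integral_wedgeExact_swap {hk : Module.finrank ℝ E = 1 + 2 * n} {μ : DForm I M (1 + 2 * n)}
    (hμ : μ.IsOrientation) {a : DForm I M 1} {c : Fin n → DForm I M 1} (ha : a.IsSmooth)
    (hc : ∀ i, (c i).IsSmooth) (i₀ : Fin n) :
    integral hk μ (wedgeExact a c) =
      integral hk μ (wedgeExact (c i₀) (Function.update c i₀ a)) := by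
  -- Cutting off `a` alone is enough: both sides are linear in `a`, the right one through `da`.
  have hsum : a = fun x => ∑ j ∈ chartIndices I M, a.mulFun (chartPartition I M j) x := by
    funext x
    simp only [DForm.mulFun]
    rw [← Finset.sum_smul, sum_chartPartition, one_smul]
  have hsm : ∀ j, (a.mulFun (chartPartition I M j)).IsSmooth := fun j =>
    ha.mulFun (chartPartition I M j).contMDiff
  have hc' : ∀ j i, (Function.update c i₀ (a.mulFun (chartPartition I M j)) i).IsSmooth :=
    fun j i => by
      by_cases h : i = i₀
      · subst h; simpa using hsm j
      · simpa [h] using hc i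
  have h1 : wedgeExact a c = fun x => ∑ j ∈ chartIndices I M,
      wedgeExact (a.mulFun (chartPartition I M j)) c x := by
    funext x
    conv_lhs => rw [hsum]
    exact wedge_wedgeProd_sum_left _ _ _
  have h2 : wedgeExact (c i₀) (Function.update c i₀ a) = fun x => ∑ j ∈ chartIndices I M,
      wedgeExact (c i₀) (Function.update c i₀ (a.mulFun (chartPartition I M j))) x := by
    funext x
    simp only [wedgeExact, d_update_eq]
    conv_lhs => rw [hsum, DForm.d_sum _ hsm]
    exact wedge_wedgeProd_update_sum _ _ _ _ _
  rw [h1, h2, integral_sum hk hμ _ fun j _ => isContinuous_wedgeExact (hsm j) hc,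
    integral_sum hk hμ _ fun j _ => isContinuous_wedgeExact (hc i₀) (hc' j)]
  exact Finset.sum_congr rfl fun j _ => integral_wedgeExact_mulFun hμ ha hc i₀ j

end Stokes

/-! ### Circle orbits and horizontality of the curvature. -/

section Cartan

set_option linter.unusedSectionVars false

open Topology

variable {E : Type*} [NormedAddCommGroup E] [NormedSpace ℝ E]
  {H : Type*} [TopologicalSpace H] {I : ModelWithCorners ℝ E H}
  {M : Type*} [TopologicalSpace M] [ChartedSpace H M]
  [MulAction Circle M] [ContMDiffSMul (𝓡 1) I ∞ Circle M]

/-- The element `e^{2πiθ}` of the circle. -/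
def circleParam (θ : ℝ) : Circle := Circle.exp (2 * Real.pi * θ)

theorem circleParam_add (s t : ℝ) : circleParam (s + t) = circleParam s * circleParam t := by
  rw [circleParam, mul_add, Circle.exp_add]; rfl

@[simp] theorem circleParam_zero : circleParam 0 = 1 := by simp [circleParam]

theorem circleParam_periodic : Function.Periodic circleParam 1 := fun θ => by
  have h : circleParam 1 = 1 := by rw [circleParam, mul_one, Circle.exp_two_pi]
  rw [circleParam_add, h, mul_one]

theorem circleParam_surjective : Function.Surjective circleParam := fun t => by
  refine ⟨Complex.arg t / (2 * Real.pi), ?_⟩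
  rw [circleParam, mul_div_cancel₀ _ (by positivity), Circle.exp_arg]

theorem contMDiff_circleParam : ContMDiff 𝓘(ℝ, ℝ) (𝓡 1) ∞ circleParam :=
  contMDiff_circleExp.comp (contMDiff_const.mul contMDiff_id : ContMDiff 𝓘(ℝ, ℝ) 𝓘(ℝ, ℝ) ∞
    fun θ : ℝ => 2 * Real.pi * θ)

variable (I) in
theorem contMDiff_const_smul' (t : Circle) : ContMDiff I I ∞ (fun x : M => t • x) :=
  ContMDiffSMul.contMDiff_const_smul (I := 𝓡 1) t

variable (I) in
theorem contMDiff_orbit (x : M) : ContMDiff 𝓘(ℝ, ℝ) I ∞ (fun θ : ℝ => circleParam θ • x) :=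
  contMDiff_circleParam.smul contMDiff_const

/-- The velocity of an orbit at an arbitrary time. -/
theorem mfderiv_orbit (x : M) (θ : ℝ) :
    (mfderiv 𝓘(ℝ, ℝ) I (fun θ : ℝ => circleParam θ • x) θ : ℝ →L[ℝ] E) 1 =
      fundamentalVector I (circleParam θ • x) := by
  have h : (fun s : ℝ => circleParam s • x) =
      (fun s : ℝ => circleParam s • (circleParam θ • x)) ∘ fun s => s - θ := by
    funext s
    simp only [Function.comp_apply]
    rw [smul_smul, ← circleParam_add, sub_add_cancel]
  have hd : DifferentiableAt ℝ (fun s : ℝ => s - θ) θ := by fun_prop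
  have hm : MDifferentiableAt 𝓘(ℝ, ℝ) I (fun s : ℝ => circleParam s • (circleParam θ • x))
      ((fun s => s - θ) θ) := (contMDiff_orbit I _).mdifferentiableAt (by simp)
  have hf : (fderiv ℝ (fun s : ℝ => s - θ) θ) 1 = 1 := by simp
  have h1 := congrArg (fun f => (mfderiv 𝓘(ℝ, ℝ) I f θ : ℝ →L[ℝ] E) 1) h
  have h2 := mfderiv_comp (f := fun s : ℝ => s - θ) θ hm hd.mdifferentiableAt
  rw [mfderiv_eq_fderiv] at h2
  refine h1.trans ((congrArg (fun L : ℝ →L[ℝ] E => L 1) h2).trans ?_)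
  change (mfderiv 𝓘(ℝ, ℝ) I (fun s : ℝ => circleParam s • (circleParam θ • x)) (θ - θ) :
    ℝ →L[ℝ] E) ((fderiv ℝ (fun s : ℝ => s - θ) θ) 1) = _
  rw [hf, sub_self]
  rfl

variable [I.Boundaryless] [IsManifold I ∞ M]

theorem IsNormalizedConnection.apply_mfderiv_orbit {α : DForm I M 1}
    (hα : IsNormalizedConnection α) (x : M) (θ : ℝ) :
    α.pull (fun θ : ℝ => circleParam θ • x) θ (fun _ => 1) = 1 := by
  refine Eq.trans ?_ (hα.apply_fundamentalVector (circleParam θ • x))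
  rw [DForm.pull_apply]
  congr 1
  funext i
  exact mfderiv_orbit (I := I) x θ

theorem IsNormalizedConnection.pullback_smul {α : DForm I M 1}
    (hα : IsNormalizedConnection α) (t : Circle) :
    α.pullback I (fun x : M => t • x) = α := funext fun x => hα.invariant t x

variable (I) in
/-- The action on points of a chart. -/
def chartAction (x₀ : M) (p : ℝ × E) : M := circleParam p.1 • (extChartAt I x₀).symm p.2

omit [I.Boundaryless] in
theorem contMDiffAt_chartAction [I.Boundaryless] {x₀ : M} {p : ℝ × E} (hp : p.2 ∈ (extChartAt I x₀).target) :
    ContMDiffAt 𝓘(ℝ, ℝ × E) I ∞ (chartAction I x₀) p := by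
  refine ContMDiffAt.smul (I := 𝓡 1) ?_ ?_
  · exact (contMDiff_circleParam _).comp p contDiff_fst.contMDiff.contMDiffAt
  · exact (contMDiffAt_extChartAt_symm hp).comp p contDiff_snd.contMDiff.contMDiffAt

/-- At a frozen time the action on a chart is a translation after the inverse chart. Invariance and
averaging both enter through this identity. -/
theorem DForm.pull_chartAction_inr (η : DForm I M 1) {x₀ : M} {p : ℝ × E}
    (hp : p.2 ∈ (extChartAt I x₀).target) (w : E) :
    η.pull (chartAction I x₀) p (fun _ => (0, w)) =
      (η.pullback I fun x : M => circleParam p.1 • x).inChart x₀ p.2 (fun _ => w) := by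
  have hd : HasFDerivAt (fun y : E => (p.1, y)) (ContinuousLinearMap.inr ℝ ℝ E) p.2 :=
    hasFDerivAt_prodMk_right _ _
  have h := η.pull_comp (f := chartAction I x₀) (g := fun y : E => (p.1, y)) (z := p.2)
    ((contMDiffAt_chartAction (p := (p.1, p.2)) hp).mdifferentiableAt (by simp)) hd.differentiableAt
  rw [DForm.inChart_eq_pull, DForm.pull_pullback _
    ((contMDiff_const_smul' I _).mdifferentiableAt (by simp))
    (mdifferentiableAt_extChartAt_symm hp)]
  have h' := congrArg (fun f => f fun _ => w) h
  rw [hd.fderiv] at h'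
  exact h'.symm

theorem IsNormalizedConnection.pull_chartAction_inl {α : DForm I M 1}
    (hα : IsNormalizedConnection α) {x₀ : M} {p : ℝ × E}
    (hp : p.2 ∈ (extChartAt I x₀).target) :
    α.pull (chartAction I x₀) p (fun _ => (1, 0)) = 1 := by
  have hd : HasFDerivAt (fun t : ℝ => (t, p.2)) (ContinuousLinearMap.inl ℝ ℝ E) p.1 :=
    hasFDerivAt_prodMk_left _ _
  have h := α.pull_comp (f := chartAction I x₀) (g := fun t : ℝ => (t, p.2)) (z := p.1)
    ((contMDiffAt_chartAction (p := (p.1, p.2)) hp).mdifferentiableAt (by simp)) hd.differentiableAt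
  have h' := congrArg (fun f => f fun _ => (1 : ℝ)) h
  rw [hd.fderiv] at h'
  exact h'.symm.trans (hα.apply_mfderiv_orbit ((extChartAt I x₀).symm p.2) p.1)

/-- The curvature of a connection form is horizontal. -/
theorem IsNormalizedConnection.d_apply_fundamentalVector {α : DForm I M 1}
    (hα : IsNormalizedConnection α) (x : M) (w : TangentSpace I x) :
    α.d x ![fundamentalVector I x, w] = 0 := by
  have hx := mem_extChartAt_target (I := I) x
  set p : ℝ × E := (0, extChartAt I x x) with hp
  set w' : E := (mfderiv I 𝓘(ℝ, E) (extChartAt I x) x : E →L[ℝ] E) w with hw'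
  have hf := contMDiffAt_chartAction (I := I) (x₀ := x) (p := p) hx
  have hnear : ∀ᶠ q : ℝ × E in 𝓝 p, q.2 ∈ (extChartAt I x).target :=
    continuous_snd.continuousAt.preimage_mem_nhds ((isOpen_extChartAt_target x).mem_nhds hx)
  -- On the product of time and chart, the pulled-back form has value `1` on the time direction by
  -- normalization, and by invariance its value on `w'` does not depend on time. Both derivatives in
  -- `d` therefore vanish.
  have hzero : extDeriv (α.pull (chartAction I x)) p ![(1, 0), (0, w')] = 0 := by
    rw [extDeriv_one_apply ((hα.smooth.contDiffAt_pull hf).differentiableAt (by simp))]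
    simp only [Matrix.cons_val_zero, Matrix.cons_val_one]
    have h1 : (fun z => α.pull (chartAction I x) z fun _ => ((1 : ℝ), (0 : E))) =ᶠ[𝓝 p]
        fun _ => 1 := by
      filter_upwards [hnear] with q hq
      exact hα.pull_chartAction_inl hq
    have h2 : (fun z => α.pull (chartAction I x) z fun _ => ((0 : ℝ), w')) =ᶠ[𝓝 p]
        (fun y => α.inChart x y fun _ => w') ∘ Prod.snd := by
      filter_upwards [hnear] with q hq
      rw [DForm.pull_chartAction_inr α hq, hα.pullback_smul]
      rfl
    have h3 : DifferentiableAt ℝ (fun y => α.inChart x y fun _ => w') p.2 :=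
      ((ContinuousAlternatingMap.apply ℝ E ℝ (fun _ : Fin 1 => w')).contDiff.contDiffAt.comp _
        (hα.smooth.contDiffAt_inChart hx)).differentiableAt (by simp)
    rw [h1.fderiv_eq, h2.fderiv_eq, fderiv_comp p h3 differentiableAt_snd, fderiv_snd]
    simp
  rw [hα.smooth.extDeriv_pull hf] at hzero
  refine Eq.trans ?_ hzero
  have hinl : HasFDerivAt (fun t : ℝ => (t, p.2)) (ContinuousLinearMap.inl ℝ ℝ E) 0 :=
    hasFDerivAt_prodMk_left _ _
  have hinr : HasFDerivAt (fun y : E => ((0 : ℝ), y)) (ContinuousLinearMap.inr ℝ ℝ E) p.2 :=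
    hasFDerivAt_prodMk_right _ _
  have hfd : MDifferentiableAt 𝓘(ℝ, ℝ × E) I (chartAction I x) p :=
    hf.mdifferentiableAt (by simp)
  have e1 : (mfderiv 𝓘(ℝ, ℝ × E) I (chartAction I x) p : ℝ × E →L[ℝ] E) (1, 0) =
      (fundamentalVector I x : E) := by
    have h := mfderiv_comp (I := 𝓘(ℝ, ℝ)) (0 : ℝ) (f := fun t : ℝ => (t, p.2)) (g := chartAction I x)
      hfd hinl.differentiableAt.mdifferentiableAt
    rw [mfderiv_eq_fderiv, hinl.fderiv] at h
    have h' := congrArg (fun L : ℝ →L[ℝ] E => L 1) h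
    refine Eq.trans h'.symm ?_
    have h'' : chartAction I x ∘ (fun t : ℝ => (t, p.2)) = fun t : ℝ => circleParam t • x := by
      funext t
      simp [chartAction, hp]
    rw [h'']
    rfl
  have e2 : (mfderiv 𝓘(ℝ, ℝ × E) I (chartAction I x) p : ℝ × E →L[ℝ] E) (0, w') = (w : E) := by
    have h := mfderiv_comp (I := 𝓘(ℝ, E)) p.2 (f := fun y : E => ((0 : ℝ), y)) (g := chartAction I x)
      hfd hinr.differentiableAt.mdifferentiableAt
    rw [mfderiv_eq_fderiv, hinr.fderiv] at h
    have h' := congrArg (fun L : E →L[ℝ] E => L w') h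
    refine Eq.trans h'.symm ?_
    have h'' : chartAction I x ∘ (fun y : E => ((0 : ℝ), y)) = (extChartAt I x).symm := by
      funext t
      simp [chartAction]
    rw [h'']
    exact mfderiv_extChartAt_symm_apply' (I := I) (E := E) (mem_extChartAt_source x) w
  have key : ∀ x', x' = x → ∀ u u' : Fin 2 → E, u = u' →
      (α.d x : E [⋀^Fin 2]→L[ℝ] ℝ) u = (α.d x' : E [⋀^Fin 2]→L[ℝ] ℝ) u' := by
    rintro _ rfl _ _ rfl; rfl
  refine key _ (by simp [chartAction, hp]) _ _ (funext fun i => ?_)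
  fin_cases i
  · exact e1.symm
  · exact e2.symm

end Cartan

/-! ### Smooth dependence of integrals on parameters. -/

section ParametricIntegral

open MeasureTheory Convolution

/-- The integral over `[0, 1]` of a smooth function of a real variable and a parameter is a smooth
function of the parameter. -/
theorem contDiffOn_intervalIntegral_param {E G : Type*} [NormedAddCommGroup E] [NormedSpace ℝ E]
    [NormedAddCommGroup G] [NormedSpace ℝ G] [CompleteSpace G] {P : ℝ × E → G} {U : Set E}
    (hU : IsOpen U) (hP : ∀ s, ∀ y ∈ U, ContDiffAt ℝ ∞ P (s, y)) :
    ContDiffOn ℝ ∞ (fun y => ∫ s in (0 : ℝ)..1, P (s, y)) U := by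
  -- The integral is the convolution at `0` of the indicator of `(0, 1]` with `x ↦ P (-x, y)`. The
  -- bump is `1` on `[-1, 1]`, so it does not affect the value, and it supplies the compact support
  -- required for smoothness of convolutions with parameters.
  let χ : ContDiffBump (0 : ℝ) := ⟨1, 2, one_pos, one_lt_two⟩
  let f : ℝ → ℝ := (Set.Ioc (0 : ℝ) 1).indicator fun _ => 1
  let g : E → ℝ → G := fun y x => χ x • P (-x, y)
  have hf : LocallyIntegrable f volume :=
    ((integrable_indicator_iff measurableSet_Ioc).2
      (integrableOn_const (by simp))).locallyIntegrable
  have hg : ContDiffOn ℝ ∞ (Function.uncurry g) (U ×ˢ Set.univ) := by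
    rintro ⟨y, x⟩ ⟨hy, -⟩
    refine ContDiffAt.contDiffWithinAt ?_
    have h1 : ContDiffAt ℝ ∞ (fun q : E × ℝ => χ q.2) (y, x) :=
      (χ.contDiff.comp contDiff_snd).contDiffAt
    have h2 : ContDiffAt ℝ ∞ (fun q : E × ℝ => P (-q.2, q.1)) (y, x) :=
      (hP (-x) y hy).comp (f := fun q : E × ℝ => (-q.2, q.1)) (y, x)
        (contDiff_snd.neg.prodMk contDiff_fst).contDiffAt
    exact h1.smul h2
  have h := contDiffOn_convolution_right_with_param_comp (μ := volume) (n := ⊤)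
    (ContinuousLinearMap.lsmul ℝ ℝ : ℝ →L[ℝ] G →L[ℝ] G) (v := fun _ : E => (0 : ℝ))
    (s := U) contDiffOn_const (f := f) (g := g) (k := Metric.closedBall 0 2) hU
    (isCompact_closedBall _ _) (fun y x _ hx => by
      have : χ x = 0 := χ.zero_of_le_dist (not_le.1 hx).le
      simp [g, this]) hf hg
  refine h.congr fun y _ => ?_
  rw [convolution_lsmul, intervalIntegral.integral_of_le zero_le_one,
    ← integral_indicator measurableSet_Ioc]
  refine integral_congr_ae (Filter.Eventually.of_forall fun s => ?_)
  by_cases hs : s ∈ Set.Ioc (0 : ℝ) 1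
  · have hχ : χ (0 - s) = 1 := χ.one_of_mem_closedBall (by
      simp only [zero_sub, Metric.mem_closedBall, dist_zero_right, norm_neg, Real.norm_eq_abs]
      exact abs_le.2 ⟨by linarith [hs.1], hs.2⟩)
    simp only [f, g, Set.indicator_of_mem hs, one_smul, hχ]
    simp
  · simp only [f, Set.indicator_of_notMem hs, zero_smul]

end ParametricIntegral

/-! ### Curves with zero velocity. -/

section ZeroDerivative

variable {E : Type*} [NormedAddCommGroup E] [NormedSpace ℝ E]
  {H : Type*} [TopologicalSpace H] {I : ModelWithCorners ℝ E H}
  {M : Type*} [TopologicalSpace M] [ChartedSpace H M] [IsManifold I ∞ M]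

/-- A curve in a manifold with vanishing velocity is constant. -/
theorem eq_of_mfderiv_curve_eq_zero {f : ℝ → M} (hf : ContMDiff 𝓘(ℝ, ℝ) I ∞ f)
    (h0 : ∀ t, (mfderiv 𝓘(ℝ, ℝ) I f t : ℝ →L[ℝ] E) = 0) (s t : ℝ) : f s = f t := by
  have hloc : IsLocallyConstant f := by
    refine (IsLocallyConstant.iff_eventually_eq f).2 fun t => ?_
    have hsrc := hf.continuous.continuousAt.preimage_mem_nhds
      ((isOpen_extChartAt_source (I := I) (f t)).mem_nhds (mem_extChartAt_source (f t)))
    obtain ⟨ε, hε, hball⟩ := Metric.mem_nhds_iff.1 hsrc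
    filter_upwards [Metric.ball_mem_nhds t hε] with z hz
    have hd : ∀ u ∈ Metric.ball t ε, ContDiffAt ℝ ∞ (extChartAt I (f t) ∘ f) u := fun u hu =>
      contDiffAt_extChartAt_comp (hf u) (hball hu)
    have hd0 : ∀ u ∈ Metric.ball t ε, fderiv ℝ (extChartAt I (f t) ∘ f) u = 0 := fun u hu => by
      rw [← mfderiv_eq_fderiv, mfderiv_comp u (mdifferentiableAt_extChartAt (by simpa using hball hu))
        (hf.mdifferentiableAt (by simp))]
      exact (congrArg (fun L : ℝ →L[ℝ] E =>
        (mfderiv I 𝓘(ℝ, E) (extChartAt I (f t)) (f u) : E →L[ℝ] E).comp L) (h0 u)).trans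
        (ContinuousLinearMap.comp_zero _)
    have h := Metric.isOpen_ball.is_const_of_fderiv_eq_zero (𝕜 := ℝ)
      (convex_ball t ε).isPreconnected
      (fun u hu => ((hd u hu).differentiableAt (by simp)).differentiableWithinAt) hd0
      hz (Metric.mem_ball_self hε)
    exact (extChartAt I (f t)).injOn (hball hz) (hball (Metric.mem_ball_self hε)) h
  exact hloc.apply_eq_of_isPreconnected isPreconnected_univ (Set.mem_univ s) (Set.mem_univ t)

end ZeroDerivative

/-! ### A one-form equal to `1` on the fundamental field. -/

section Existence

open MeasureTheory Topology

set_option linter.unusedSectionVars false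

variable {E : Type*} [NormedAddCommGroup E] [NormedSpace ℝ E]
  {H : Type*} [TopologicalSpace H] {I : ModelWithCorners ℝ E H}
  {M : Type*} [TopologicalSpace M] [ChartedSpace H M]
  [MulAction Circle M] [ContMDiffSMul (𝓡 1) I ∞ Circle M]

/-- Equivariant maps preserve fundamental vectors. -/
theorem mfderiv_fundamentalVector {E' : Type*} [NormedAddCommGroup E'] [NormedSpace ℝ E']
    {H' : Type*} [TopologicalSpace H'] {J : ModelWithCorners ℝ E' H'}
    {N : Type*} [TopologicalSpace N] [ChartedSpace H' N] [MulAction Circle N]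
    {f : M → N} (hf : ContMDiff I J ∞ f) (hequiv : ∀ (t : Circle) x, f (t • x) = t • f x) (x : M) :
    (mfderiv I J f x : E →L[ℝ] E') (fundamentalVector I x : E) = (fundamentalVector J (f x) : E') := by
  have hx : circleParam 0 • x = x := by simp
  have hf' : MDifferentiableAt I J f (circleParam 0 • x) := hf.mdifferentiableAt (by simp)
  have h := mfderiv_comp (I := 𝓘(ℝ, ℝ)) (0 : ℝ) (f := fun θ : ℝ => circleParam θ • x) (g := f)
    hf' ((contMDiff_orbit I x).mdifferentiableAt (by simp))
  have h1 := congrArg (fun L : ℝ →L[ℝ] E' => L 1) h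
  have h2 : f ∘ (fun θ : ℝ => circleParam θ • x) = fun θ : ℝ => circleParam θ • f x :=
    funext fun θ => hequiv _ _
  have h3 := congrArg (fun f => (mfderiv 𝓘(ℝ, ℝ) J f 0 : ℝ →L[ℝ] E') 1) h2
  have h4 : ∀ x', x' = x → ∀ v : E, (mfderiv I J f x : E →L[ℝ] E') v =
      (mfderiv I J f x' : E →L[ℝ] E') v := by rintro _ rfl _; rfl
  refine (h4 _ hx _).trans (h1.symm.trans h3)

/-- The circle is commutative, so translations are themselves equivariant. -/
theorem fundamentalVector_smul (t : Circle) (x : M) :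
    (mfderiv I I (fun y : M => t • y) x : E →L[ℝ] E) (fundamentalVector I x : E) =
      (fundamentalVector I (t • x) : E) :=
  mfderiv_fundamentalVector (contMDiff_const_smul' I t) (fun s x => smul_comm t s x) x

/-- A zero of the field at `x` is carried along the whole orbit by translations, so the orbit has
zero velocity and `x` is fixed. -/
theorem fundamentalVector_ne_zero [IsManifold I ∞ M]
    (hfree : MulAction.fixedPoints Circle M = ∅) (x : M) :
    (fundamentalVector I x : E) ≠ 0 := by
  intro h0
  have hconst := eq_of_mfderiv_curve_eq_zero (contMDiff_orbit I x) (fun θ => by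
    refine ContinuousLinearMap.ext_ring ?_
    refine (mfderiv_orbit (I := I) x θ).trans ?_
    refine (fundamentalVector_smul (I := I) (circleParam θ) x).symm.trans ?_
    rw [h0]
    exact map_zero _)
  have hx : x ∈ MulAction.fixedPoints Circle M := fun t => by
    obtain ⟨θ, rfl⟩ := circleParam_surjective t
    simpa using hconst θ 0
  rw [hfree] at hx
  exact hx

variable [I.Boundaryless] [IsManifold I ∞ M]

/-- A fixed-point-free action on a closed manifold admits a smooth form which is `1` on the
fundamental vector field. -/
theorem exists_isSmooth_apply_fundamentalVector_eq_one [FiniteDimensional ℝ E] [T2Space M]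
    [CompactSpace M] (hfree : MulAction.fixedPoints Circle M = ∅) :
    ∃ lam : DForm I M 1, lam.IsSmooth ∧ ∀ x, lam x (fun _ => fundamentalVector I x) = 1 := by
  -- With `N = de(X)`, nonzero because `e` is an immersion and the fundamental field `X` has no
  -- zeros, the form is `⟨N, de⟩ / ‖N‖²`.
  obtain ⟨m, e, he, -, hinj⟩ := exists_embedding_euclidean_of_compact (I := I) (M := M)
  let V := EuclideanSpace ℝ (Fin m)
  let N : M → V := fun x => deriv (fun θ : ℝ => e (circleParam θ • x)) 0
  have hN : ∀ x, (mfderiv I 𝓘(ℝ, V) e x : E →L[ℝ] V) (fundamentalVector I x : E) = N x := by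
    intro x
    have hx : circleParam 0 • x = x := by simp
    have h := mfderiv_comp (I := 𝓘(ℝ, ℝ)) (0 : ℝ) (f := fun θ : ℝ => circleParam θ • x) (g := e)
      (he.mdifferentiableAt (by simp)) ((contMDiff_orbit I x).mdifferentiableAt (by simp))
    rw [mfderiv_eq_fderiv] at h
    have h1 := congrArg (fun L : ℝ →L[ℝ] V => L 1) h
    have h4 : ∀ x', x' = x → ∀ v : E, (mfderiv I 𝓘(ℝ, V) e x : E →L[ℝ] V) v =
      (mfderiv I 𝓘(ℝ, V) e x' : E →L[ℝ] V) v := by rintro _ rfl _; rfl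
    exact (h4 _ hx _).trans h1.symm
  have hN0 : ∀ x, N x ≠ 0 := fun x h => fundamentalVector_ne_zero (I := I) hfree x
    (hinj x ((hN x).trans (h.trans (map_zero (mfderiv I 𝓘(ℝ, V) e x : E →L[ℝ] V)).symm)))
  let c : M → V →L[ℝ] ℝ := fun x => (‖N x‖ ^ 2)⁻¹ • innerSL ℝ (N x)
  have hc : ∀ x, c x (N x) = 1 := fun x => by
    have : ‖N x‖ ^ 2 ≠ 0 := pow_ne_zero _ (norm_ne_zero_iff.2 (hN0 x))
    simp only [c, smul_apply, innerSL_apply_apply, real_inner_self_eq_norm_sq, smul_eq_mul]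
    exact inv_mul_cancel₀ this
  let of1 := ContinuousAlternatingMap.ofSubsingletonLIE (𝕜 := ℝ) (E := E) (F := ℝ) (0 : Fin 1)
  let lam : DForm I M 1 := fun x => of1 ((c x).comp (mfderiv I 𝓘(ℝ, V) e x : E →L[ℝ] V))
  refine ⟨lam, DForm.isSmooth_of_contDiffAt fun x₀ y hy => ?_, fun x => ?_⟩
  · have hex : ContDiffAt ℝ ∞ (e ∘ (extChartAt I x₀).symm) y :=
      ((he _).comp y (contMDiffAt_extChartAt_symm hy)).contDiffAt
    have hact : ∀ z ∈ (extChartAt I x₀).target,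
        ContDiffAt ℝ ∞ (e ∘ chartAction I x₀) ((0 : ℝ), z) := fun z hz =>
      ((he _).comp ((0 : ℝ), z) (contMDiffAt_chartAction (p := ((0 : ℝ), z)) hz)).contDiffAt
    -- In a chart `N` is a partial derivative of a map jointly smooth in time and position, hence
    -- smooth.
    let N' : E → V := fun z => fderiv ℝ (e ∘ chartAction I x₀) ((0 : ℝ), z) (1, 0)
    have hN' : ∀ z ∈ (extChartAt I x₀).target, N ((extChartAt I x₀).symm z) = N' z := by
      intro z hz
      have hinl : HasFDerivAt (fun t : ℝ => (t, z)) (ContinuousLinearMap.inl ℝ ℝ E) 0 :=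
        hasFDerivAt_prodMk_left _ _
      have h := fderiv_comp (𝕜 := ℝ) (0 : ℝ) (f := fun t : ℝ => (t, z)) (g := e ∘ chartAction I x₀)
        ((hact z hz).differentiableAt (by simp)) hinl.differentiableAt
      rw [hinl.fderiv] at h
      exact congrArg (fun L : ℝ →L[ℝ] V => L 1) h
    have hN's : ContDiffAt ℝ ∞ N' y := by
      have h1 : ContDiffAt ℝ ∞ (fun z : E => fderiv ℝ (e ∘ chartAction I x₀) ((0 : ℝ), z)) y :=
        ((hact y hy).fderiv_right (m := ∞) (by simp)).comp (f := fun z : E => ((0 : ℝ), z)) y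
          (contDiffAt_const.prodMk contDiffAt_id)
      exact h1.clm_apply contDiffAt_const
    have hne : ‖N' y‖ ^ 2 ≠ 0 := by
      rw [← hN' y hy]; exact pow_ne_zero _ (norm_ne_zero_iff.2 (hN0 _))
    have hmain : ContDiffAt ℝ ∞ (fun z => of1 (((‖N' z‖ ^ 2)⁻¹ • innerSL ℝ (N' z)).comp
        (fderiv ℝ (e ∘ (extChartAt I x₀).symm) z))) y :=
      of1.contDiff.contDiffAt.comp y (((hN's.norm_sq ℝ).inv hne).smul
        ((innerSL ℝ : V →L[ℝ] V →L[ℝ] ℝ).contDiff.contDiffAt.comp y hN's) |>.clm_comp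
        (hex.fderiv_right (by simp)))
    refine hmain.congr_of_eventuallyEq ?_
    filter_upwards [(isOpen_extChartAt_target x₀).mem_nhds hy] with z hz
    rw [← hN' z hz, ← mfderiv_eq_fderiv, mfderiv_comp z (he.mdifferentiableAt (by simp))
      (mdifferentiableAt_extChartAt_symm hz)]
    rfl
  · change c x ((mfderiv I 𝓘(ℝ, V) e x : E →L[ℝ] V) (fundamentalVector I x : E)) = 1
    rw [hN, hc]

end Existence

/-! ### Pullback by a fixed linear map commutes with integration. -/

section CompIntegral

variable {E F : Type*} [NormedAddCommGroup E] [NormedSpace ℝ E] [NormedAddCommGroup F]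
  [NormedSpace ℝ F]

theorem continuous_compContinuousLinearMap_const (L : F →L[ℝ] E) {f : ℝ → E [⋀^Fin 1]→L[ℝ] ℝ}
    (hf : Continuous f) : Continuous fun θ => (f θ).compContinuousLinearMap L :=
  (ContinuousAlternatingMap.compContinuousLinearMapCLM L).continuous.comp hf

theorem intervalIntegral_compContinuousLinearMap (L : F →L[ℝ] E)
    {f : ℝ → E [⋀^Fin 1]→L[ℝ] ℝ} (hf : Continuous f) (a b : ℝ) :
    (∫ θ in a..b, f θ).compContinuousLinearMap L =
      ∫ θ in a..b, (f θ).compContinuousLinearMap L :=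
  ((ContinuousAlternatingMap.compContinuousLinearMapCLM L).intervalIntegral_comp_comm
    (hf.intervalIntegrable a b)).symm

end CompIntegral

/-! ### Averaging over the circle; existence of connection forms. -/

section Average

open MeasureTheory Topology

set_option linter.unusedSectionVars false

variable {E : Type*} [NormedAddCommGroup E] [NormedSpace ℝ E]
  {H : Type*} [TopologicalSpace H] {I : ModelWithCorners ℝ E H} [I.Boundaryless]
  {M : Type*} [TopologicalSpace M] [ChartedSpace H M] [IsManifold I ∞ M]
  [MulAction Circle M] [ContMDiffSMul (𝓡 1) I ∞ Circle M]

/-- The translate of a one-form by `e^{2πiθ}`, at a point. -/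
def DForm.translate (lam : DForm I M 1) (x : M) (θ : ℝ) : E [⋀^Fin 1]→L[ℝ] ℝ :=
  lam.pullback I (fun y : M => circleParam θ • y) x

/-- The average of a one-form over the circle. -/
def DForm.average (lam : DForm I M 1) : DForm I M 1 := fun x =>
  (∫ θ in (0 : ℝ)..1, lam.translate x θ : E [⋀^Fin 1]→L[ℝ] ℝ)

/-- The translates of a one-form in a chart. -/
def DForm.translateInChart (lam : DForm I M 1) (x₀ : M) (p : ℝ × E) : E [⋀^Fin 1]→L[ℝ] ℝ :=
  (lam.pull (chartAction I x₀) p).compContinuousLinearMap (ContinuousLinearMap.inr ℝ ℝ E)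

theorem DForm.translateInChart_eq (lam : DForm I M 1) {x₀ : M} {y : E}
    (hy : y ∈ (extChartAt I x₀).target) (θ : ℝ) :
    lam.translateInChart x₀ (θ, y) =
      (lam.translate ((extChartAt I x₀).symm y) θ).compContinuousLinearMap
        (mfderiv 𝓘(ℝ, E) I (extChartAt I x₀).symm y : E →L[ℝ] E) := by
  ext v
  have hv : v = fun _ => v 0 := funext fun i => by rw [Subsingleton.elim i 0]
  rw [hv]
  exact lam.pull_chartAction_inr (p := (θ, y)) hy (v 0)

theorem DForm.IsSmooth.contDiffAt_translateInChart {lam : DForm I M 1} (hlam : lam.IsSmooth)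
    {x₀ : M} {y : E} (hy : y ∈ (extChartAt I x₀).target) (θ : ℝ) :
    ContDiffAt ℝ ∞ (lam.translateInChart x₀) (θ, y) :=
  ContDiffAt.compContinuousLinearMap_one
    (hlam.contDiffAt_pull (contMDiffAt_chartAction (p := (θ, y)) hy)) contDiffAt_const

/-- Expresses the translates through a family jointly smooth in time and position, which yields
continuity in `θ` and so integrability. -/
theorem DForm.translate_eq (lam : DForm I M 1) (x : M) (θ : ℝ) :
    lam.translate x θ = (lam.translateInChart x (θ, extChartAt I x x)).compContinuousLinearMap
      (mfderiv I 𝓘(ℝ, E) (extChartAt I x) x : E →L[ℝ] E) := by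
  rw [lam.translateInChart_eq (mem_extChartAt_target x)]
  ext v
  change lam.translate x θ v = lam.translate _ θ fun i =>
    (mfderiv 𝓘(ℝ, E) I (extChartAt I x).symm (extChartAt I x x) : E →L[ℝ] E)
      ((mfderiv I 𝓘(ℝ, E) (extChartAt I x) x : E →L[ℝ] E) (v i))
  rw [extChartAt_to_inv]
  congr 1
  funext i
  exact (mfderiv_extChartAt_symm_apply' (I := I) (mem_extChartAt_source x) (v i)).symm

theorem DForm.IsSmooth.continuous_translate {lam : DForm I M 1} (hlam : lam.IsSmooth) (x : M) :
    Continuous (lam.translate x) := by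
  rw [show lam.translate x = _ from funext fun θ => lam.translate_eq x θ]
  refine continuous_compContinuousLinearMap_const (E := E) (F := E) _ (continuous_iff_continuousAt.2 fun θ => ?_)
  exact (hlam.contDiffAt_translateInChart (mem_extChartAt_target x) θ).continuousAt.comp
    (f := fun θ : ℝ => (θ, extChartAt I x x)) (by fun_prop)

theorem DForm.IsSmooth.average_apply {lam : DForm I M 1} (hlam : lam.IsSmooth) (x : M)
    (v : Fin 1 → E) : (lam.average x : E [⋀^Fin 1]→L[ℝ] ℝ) v =
      ∫ θ in (0 : ℝ)..1, lam.translate x θ v :=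
  ((ContinuousAlternatingMap.apply ℝ E ℝ v).intervalIntegral_comp_comm
    ((hlam.continuous_translate x).intervalIntegrable 0 1)).symm

theorem DForm.IsSmooth.average {lam : DForm I M 1} (hlam : lam.IsSmooth) :
    lam.average.IsSmooth := by
  intro x₀
  refine (contDiffOn_intervalIntegral_param (isOpen_extChartAt_target x₀)
    (fun θ y hy => hlam.contDiffAt_translateInChart hy θ)).congr fun y hy => ?_
  simp only [lam.translateInChart_eq hy]
  exact intervalIntegral_compContinuousLinearMap (E := E) (F := E) _ (hlam.continuous_translate _) 0 1

/-- Turns invariance of the average into a shift of the integration variable. -/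
theorem DForm.translate_smul (lam : DForm I M 1) (x : M) (s θ : ℝ) (v : Fin 1 → E) :
    lam.translate (circleParam s • x) θ (fun i =>
      (mfderiv I I (fun y : M => circleParam s • y) x : E →L[ℝ] E) (v i)) =
      lam.translate x (θ + s) v := by
  have h : (fun y : M => circleParam (θ + s) • y) =
      (fun y : M => circleParam θ • y) ∘ fun y => circleParam s • y := by
    funext y
    simp only [Function.comp_apply]
    rw [smul_smul, ← circleParam_add]
  have h1 := mfderiv_comp x (f := fun y : M => circleParam s • y)
    (g := fun y : M => circleParam θ • y)
    ((contMDiff_const_smul' I (circleParam θ)).mdifferentiableAt (by simp))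
    ((contMDiff_const_smul' I (circleParam s)).mdifferentiableAt (by simp))
  have h2 : lam.translate x (θ + s) =
      (lam.pullback I ((fun y : M => circleParam θ • y) ∘ fun y => circleParam s • y) x :
        E [⋀^Fin 1]→L[ℝ] ℝ) := congrArg (fun f => (lam.pullback I f x : E [⋀^Fin 1]→L[ℝ] ℝ)) h
  rw [h2, DForm.pullback, h1]
  rfl

theorem isNormalizedConnection_average {lam : DForm I M 1} (hlam : lam.IsSmooth)
    (h1 : ∀ x, lam x (fun _ => fundamentalVector I x) = 1) :
    IsNormalizedConnection lam.average where
  smooth := hlam.average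
  apply_fundamentalVector x := by
    refine (hlam.average_apply x _).trans ?_
    have h : ∀ θ : ℝ, lam.translate x θ (fun _ => (fundamentalVector I x : E)) = 1 := by
      intro θ
      refine Eq.trans ?_ (h1 (circleParam θ • x))
      change lam (circleParam θ • x) (fun _ => (mfderiv I I (fun y : M => circleParam θ • y) x :
        E →L[ℝ] E) (fundamentalVector I x : E)) = _
      congr 1
      funext i
      exact fundamentalVector_smul (I := I) (circleParam θ) x
    refine (intervalIntegral.integral_congr (g := fun _ => (1 : ℝ)) fun θ _ => h θ).trans ?_
    simp
  invariant t x := by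
    obtain ⟨s, rfl⟩ := circleParam_surjective t
    ext v
    refine (hlam.average_apply (circleParam s • x) (fun i =>
      (mfderiv I I (fun y : M => circleParam s • y) x : E →L[ℝ] E) (v i))).trans ?_
    refine Eq.trans ?_ (hlam.average_apply x v).symm
    refine (intervalIntegral.integral_congr fun θ _ => lam.translate_smul x s θ v).trans ?_
    rw [intervalIntegral.integral_comp_add_right (fun θ => lam.translate x θ v)]
    have hper : Function.Periodic (fun θ => lam.translate x θ v) 1 := fun θ => by
      have : (fun y : M => circleParam (θ + 1) • y) = fun y : M => circleParam θ • y := by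
        funext y; rw [circleParam_periodic θ]
      exact congrArg (fun f => (lam.pullback I f x : E [⋀^Fin 1]→L[ℝ] ℝ) v) this
    -- The shifted integral runs over `[s, s + 1]`, again a full period.
    have := hper.intervalIntegral_add_eq s 0
    rw [zero_add, add_comm s 1] at this
    rwa [zero_add]

theorem exists_isNormalizedConnection [FiniteDimensional ℝ E] [T2Space M] [CompactSpace M]
    (hfree : MulAction.fixedPoints Circle M = ∅) :
    ∃ α : DForm I M 1, IsNormalizedConnection α := by
  obtain ⟨lam, hlam, h1⟩ := exists_isSmooth_apply_fundamentalVector_eq_one (I := I) hfree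
  exact ⟨lam.average, isNormalizedConnection_average hlam h1⟩

end Average

/-! ### Comparison of connection forms and vanishing of the Chern number. -/

section Main

set_option linter.unusedSectionVars false

section

variable {E : Type*} [NormedAddCommGroup E] [NormedSpace ℝ E]
  {H : Type*} [TopologicalSpace H] {I : ModelWithCorners ℝ E H} [I.Boundaryless]
  {M : Type*} [TopologicalSpace M] [ChartedSpace H M] [IsManifold I ∞ M]
  [MulAction Circle M] [ContMDiffSMul (𝓡 1) I ∞ Circle M]
  {E' : Type*} [NormedAddCommGroup E'] [NormedSpace ℝ E']
  {H' : Type*} [TopologicalSpace H'] {J : ModelWithCorners ℝ E' H'} [J.Boundaryless]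
  {N : Type*} [TopologicalSpace N] [ChartedSpace H' N] [IsManifold J ∞ N]
  [MulAction Circle N] [ContMDiffSMul (𝓡 1) J ∞ Circle N]

theorem IsNormalizedConnection.pullback {α : DForm J N 1} (hα : IsNormalizedConnection α)
    {f : M → N} (hf : ContMDiff I J ∞ f) (hequiv : ∀ (t : Circle) x, f (t • x) = t • f x) :
    IsNormalizedConnection (α.pullback I f) where
  smooth := hα.smooth.pullback hf
  apply_fundamentalVector x := by
    refine Eq.trans ?_ (hα.apply_fundamentalVector (f x))
    change α (f x) (fun _ => (mfderiv I J f x : E →L[ℝ] E') (fundamentalVector I x : E)) = _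
    congr 1
    funext i
    exact mfderiv_fundamentalVector hf hequiv x
  invariant t x := by
    have hcomp : f ∘ (fun y : M => t • y) = (fun z : N => t • z) ∘ f := funext fun y => hequiv t y
    have h1 := mfderiv_comp x (f := fun y : M => t • y) (g := f)
      (hf.mdifferentiableAt (by simp))
      ((contMDiff_const_smul' I t).mdifferentiableAt (by simp))
    have h2 := mfderiv_comp x (f := f) (g := fun z : N => t • z)
      ((contMDiff_const_smul' J t).mdifferentiableAt (by simp)) (hf.mdifferentiableAt (by simp))
    have h3 : (α.pullback I (f ∘ fun y : M => t • y) x : E [⋀^Fin 1]→L[ℝ] ℝ) =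
        α.pullback I ((fun z : N => t • z) ∘ f) x :=
      congrArg (fun g => (α.pullback I g x : E [⋀^Fin 1]→L[ℝ] ℝ)) hcomp
    rw [DForm.pullback, DForm.pullback, h1, h2] at h3
    refine Eq.trans h3 ?_
    have h4 := hα.invariant t (f x)
    ext v
    exact congrArg (fun w : E' [⋀^Fin 1]→L[ℝ] ℝ =>
      w fun i => (mfderiv I J f x : E →L[ℝ] E') (v i)) h4

theorem fundamentalVector_ne_zero_of_connection {α : DForm I M 1}
    (hα : IsNormalizedConnection α) (x : M) : fundamentalVector I x ≠ 0 := by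
  intro h
  have h1 := hα.apply_fundamentalVector x
  rw [h] at h1
  have h2 : α x (fun _ => 0) = 0 := (α x).map_coord_zero 0 rfl
  rw [h2] at h1
  exact zero_ne_one h1

end

variable {E : Type*} [NormedAddCommGroup E] [NormedSpace ℝ E] [FiniteDimensional ℝ E]
  [MeasurableSpace E] [BorelSpace E]
  {H : Type*} [TopologicalSpace H] {I : ModelWithCorners ℝ E H} [I.Boundaryless]
  {M : Type*} [TopologicalSpace M] [ChartedSpace H M] [IsManifold I ∞ M]
  [T2Space M] [CompactSpace M]
  [MulAction Circle M] [ContMDiffSMul (𝓡 1) I ∞ Circle M] {n : ℕ}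

/-- Connection forms are interchangeable as first factors of a product with curvatures. -/
theorem wedgeExact_eq_of_connections (hk : Module.finrank ℝ E = 1 + 2 * n) {α β : DForm I M 1}
    {c : Fin n → DForm I M 1} (hα : IsNormalizedConnection α) (hβ : IsNormalizedConnection β)
    (hc : ∀ i, IsNormalizedConnection (c i)) : wedgeExact α c = wedgeExact β c := by
  funext x
  -- The fundamental vector is nonzero and annihilates the difference `α - β` as well as each
  -- curvature.
  have h : wedge (α x - β x) (wedgeProd fun i => (c i).d x) = 0 :=
    wedge_wedgeProd_eq_zero (V := TangentSpace I x) (Module.finBasisOfFinrankEq ℝ E hk)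
      (fundamentalVector_ne_zero_of_connection hα x)
      (by
        change α x _ - β x _ = 0
        rw [hα.apply_fundamentalVector, hβ.apply_fundamentalVector, sub_self])
      fun i w => (hc i).d_apply_fundamentalVector x w
  ext v
  have h1 := wedge_wedgeProd_sub (α x) (β x) (fun i => (c i).d x) v (α x - β x) fun _ => rfl
  rw [h] at h1
  exact sub_eq_zero.1 h1.symm

/-- If `α₀ ∧ (dα₀)ⁿ` vanishes for one connection form `α₀`, then the Chern number vanishes for all
connection forms. -/
theorem chernNumber_eq_zero {hk : Module.finrank ℝ E = 1 + 2 * n} {μ : DForm I M (1 + 2 * n)}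
    (hμ : μ.IsOrientation) {α₀ α : DForm I M 1} (h₀ : IsNormalizedConnection α₀)
    (hzero : wedgeExact α₀ (fun _ : Fin n => α₀) = fun _ => 0) (hα : IsNormalizedConnection α) :
    chernNumber hk μ α = 0 := by
  -- Interpolates between `α₀` (at `m = 0`) and `α` (at `m = n`) in the curvature slots.
  let c : ℕ → Fin n → DForm I M 1 := fun m i => if (i : ℕ) < m then α else α₀
  have hc : ∀ m i, IsNormalizedConnection (c m i) := fun m i => by
    by_cases h : (i : ℕ) < m
    · simpa only [c, if_pos h] using hα
    · simpa only [c, if_neg h] using h₀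
  have key : ∀ m ≤ n, integral hk μ (wedgeExact α₀ (c m)) = 0 := by
    intro m
    induction m with
    | zero =>
      intro _
      have h : c 0 = fun _ => α₀ := funext fun i => by simp [c]
      rw [h, hzero, integral_eq_sum]
      refine Finset.sum_eq_zero fun i _ => ?_
      have h0 : ∀ y, chartCoeff hk μ (fun _ => 0) i y = 0 := fun y => by
        rw [chartCoeff, DForm.inChart_of_eq_zero (η := fun _ => 0) rfl]; simp
      simp [h0]
    | succ m ih =>
      intro hm
      have h1 : c (m + 1) ⟨m, hm⟩ = α := by simp [c]
      have h2 : Function.update (c (m + 1)) ⟨m, hm⟩ α₀ = c m := by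
        funext i
        by_cases hi : i = ⟨m, hm⟩
        · subst hi; simp [c]
        · rw [Function.update_of_ne hi]
          have hi' : (i : ℕ) ≠ m := fun h => hi (Fin.ext h)
          have h3 : (i : ℕ) < m + 1 ↔ (i : ℕ) < m := by omega
          simp only [c, h3]
      -- Stokes trades the head `α₀` for the `α` in slot `m`, which leaves `c m` in the slots; then
      -- the head is reset to `α₀`.
      rw [integral_wedgeExact_swap hμ h₀.smooth (fun i => (hc (m + 1) i).smooth) ⟨m, hm⟩, h1, h2,
        wedgeExact_eq_of_connections hk hα h₀ (hc m)]
      exact ih (by omega)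
  have hfinal := key n le_rfl
  -- All slots now hold `α`; one last change of head gives `α ∧ (dα)ⁿ`.
  rw [wedgeExact_eq_of_connections hk h₀ hα (hc n)] at hfinal
  have h : c n = fun _ => α := funext fun i => by simp [c]
  rw [h] at hfinal
  rw [← hfinal]
  refine congrArg (integral hk μ) (funext fun x => ?_)
  rw [wedgePow_eq_wedgeProd]
  rfl

variable {E' : Type*} [NormedAddCommGroup E'] [NormedSpace ℝ E'] [FiniteDimensional ℝ E']
  {H' : Type*} [TopologicalSpace H'] {J : ModelWithCorners ℝ E' H'} [J.Boundaryless]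
  {N : Type*} [TopologicalSpace N] [ChartedSpace H' N] [IsManifold J ∞ N]
  [T2Space N] [CompactSpace N]
  [MulAction Circle N] [ContMDiffSMul (𝓡 1) J ∞ Circle N]

/-- The Euler number of a closed manifold vanishes if the manifold admits an equivariant map to a
closed manifold of smaller dimension with fixed-point-free action. -/
theorem hasEulerNumber_zero_of_equivariant_map (hk : Module.finrank ℝ E = 1 + 2 * n)
    (hdim : Module.finrank ℝ E' < Module.finrank ℝ E) {μ : DForm I M (1 + 2 * n)}
    (hμ : μ.IsOrientation) {f : M → N} (hf : ContMDiff I J ∞ f)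
    (hequiv : ∀ (t : Circle) x, f (t • x) = t • f x)
    (hfree : MulAction.fixedPoints Circle N = ∅) : HasEulerNumber hk μ 0 := by
  obtain ⟨β, hβ⟩ := exists_isNormalizedConnection (I := J) hfree
  have h₀ := hβ.pullback (I := I) hf hequiv
  refine ⟨⟨_, h₀⟩, fun α hα => ?_⟩
  rw [chernNumber_eq_zero hμ h₀ ?_ hα, AddCircle.coe_zero]
  funext x
  let L : E →L[ℝ] E' := mfderiv I J f x
  -- The drop in dimension forces a kernel; both the pulled-back form and its curvature see vectors
  -- only through `L`.
  obtain ⟨Y, hY, hY0⟩ : ∃ Y : E, L Y = 0 ∧ Y ≠ 0 := by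
    obtain ⟨Y, hY, hY0⟩ := Submodule.exists_mem_ne_zero_of_ne_bot
      (LinearMap.ker_ne_bot_of_finrank_lt (f := L.toLinearMap) hdim)
    exact ⟨Y, hY, hY0⟩
  refine wedge_wedgeProd_eq_zero (V := TangentSpace I x) (Module.finBasisOfFinrankEq ℝ E hk)
    (Y := Y) hY0 ?_ fun i w => ?_
  · change β (f x) (fun _ => L Y) = 0
    rw [hY]
    exact (β (f x)).map_coord_zero 0 rfl
  · rw [hβ.smooth.d_pullback hf]
    refine (β.d (f x)).map_coord_zero 0 ?_
    exact hY

end Main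

end CircleEuler

end

/-! ### The product of two manifolds with circle actions. -/

theorem mainTheorem8 {n d₁ d₂ : ℕ} (hd₁ : 0 < d₁) (hd₂ : 0 < d₂) (hd : d₁ + d₂ = 2 * n + 1)
    {M₁ : Type*} [TopologicalSpace M₁] [ChartedSpace (EuclideanSpace ℝ (Fin d₁)) M₁]
    [IsManifold (𝓡 d₁) ∞ M₁] [T2Space M₁] [CompactSpace M₁]
    [MulAction Circle M₁] [ContMDiffSMul (𝓡 1) (𝓡 d₁) ∞ Circle M₁]
    {M₂ : Type*} [TopologicalSpace M₂] [ChartedSpace (EuclideanSpace ℝ (Fin d₂)) M₂]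
    [IsManifold (𝓡 d₂) ∞ M₂] [T2Space M₂] [CompactSpace M₂]
    [MulAction Circle M₂] [ContMDiffSMul (𝓡 1) (𝓡 d₂) ∞ Circle M₂]
    (hfree : MulAction.fixedPoints Circle (M₁ × M₂) = ∅)
    (μ : CircleEuler.DForm ((𝓡 d₁).prod (𝓡 d₂)) (M₁ × M₂) (1 + 2 * n))
    (hμ : μ.IsOrientation) :
    CircleEuler.HasEulerNumber (CircleEuler.finrank_prod_eq hd) μ 0 := by
  -- Project to a factor without fixed points. Positive dimension of the other factor makes the
  -- target strictly smaller than the product.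
  rcases Set.eq_empty_or_nonempty (MulAction.fixedPoints Circle M₁) with h₁ | ⟨x₁, h₁⟩
  · refine CircleEuler.hasEulerNumber_zero_of_equivariant_map (J := 𝓡 d₁)
      (CircleEuler.finrank_prod_eq hd) ?_ hμ (f := Prod.fst) contMDiff_fst (fun _ _ => rfl) h₁
    rw [CircleEuler.finrank_prod_eq hd, finrank_euclideanSpace_fin]
    omega
  · refine CircleEuler.hasEulerNumber_zero_of_equivariant_map (J := 𝓡 d₂)
      (CircleEuler.finrank_prod_eq hd) ?_ hμ (f := Prod.snd) contMDiff_snd (fun _ _ => rfl) ?_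
    · rw [CircleEuler.finrank_prod_eq hd, finrank_euclideanSpace_fin]
      omega
    · refine Set.eq_empty_of_forall_notMem fun x₂ h₂ => ?_
      have h : (x₁, x₂) ∈ MulAction.fixedPoints Circle (M₁ × M₂) := fun t =>
        Prod.ext (h₁ t) (h₂ t)
      rw [hfree] at h
      exact h
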